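/- Let $n\ge 2$, let $g_1,\dots,g_n$ be the standard generators of the free group $\mathbb F_n$, let $\lambda$ be the left regular representation of $\mathbb F_n$ on $\ell^2(\mathbb F_n)$, and let $L(\mathbb F_n)=\{\lambda(g):g\in\mathbb F_n\}''$ be the group von Neumann algebra with its canonical trace $\mathrm{tr}(x)=\langle x\delta_e,\delta_e\rangle$. Regard $L(\mathbb F_n)$ as a subspace of its predual $L(\mathbb F_n)_*$ (the space of normal functionals) via $x\mapsto \mathrm{tr}(\,\cdot\,x)$. The matrix norms and matrix cones on $\ell_\infty^n$ are those of the $C^*$-algebras $M_k(\ell_\infty^n)$; an element $[\varphi_{ij}]$ of $M_k(L(\mathbb F_n)_*)$ is identified with the map $x\mapsto[\varphi_{ij}(x)]$ from $L(\mathbb F_n)$ to $M_k$, it has the completely bounded norm of this map as its norm, and it is positive if this map is completely positive. Let $V=\ell_\infty^n$ and $W=L(\mathbb F_n)_*$. For $z\in V\otimes W$ (algebraic tensor product) the operator space projective norm is $$\|z\|_\wedge=\inf\{\|\alpha\|\,\|v\|\,\|w\|\,\|\beta\| : z=\alpha(v\otimes w)\beta,\ v\in M_k(V),\ w\in M_l(W),\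 \alpha\in M_{1,kl},\ \beta\in M_{kl,1},\ k,l\in\mathbb N\}.$$ Let $M_m(V\otimes_\Delta W)_+$ be the set of all $\alpha(v\otimes w)\alpha^*$ with $v\in M_k(V)^+$, $w\in M_l(W)^+$, $\alpha\in M_{m,kl}$, $k,l\in\mathbb N$; for $u$ in this cone let $|u|_\Delta=\inf\{\|\alpha\|^2\|v\|\|w\|\}$ over all such representations $u=\alpha(v\otimes w)\alpha^*$; and for $z\in V\otimes W$ let $$\|z\|_\Delta=\inf\left\{\max\{|u|_\Delta,|u'|_\Delta\} : \begin{pmatrix}u&z\\ z^*&u'\end{pmatrix}\in M_2(V\otimes_\Delta W)_+\right\}.$$ Then, with $e_1,\dots,e_n$ the standard basis of $\ell_\infty^n$, $$\Big\|\sum_{k=1}^n e_k\otimes\lambda(g_k)\Big\|_{\ell_\infty^n\otimes_\Delta L(\mathbb F_n)_*}=1\qquad\text{and}\qquad \Big\|\sum_{k=1}^n e_k\otimes\lambda(g_k)\Big\|_{\ell_\infty^n\otimes_\wedge L(\mathbb F_n)_*}\ge\frac{n}{2\sqrt{n-1}}.$$ -/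

import Mathlib

open scoped TensorProduct ComplexOrder Matrix.Norms.L2Operator

noncomputable section

/-! ### Matrix norms and matrix cones -/

/-- The matrix norms and the matrix cones of a matrix ordered operator space `V`: `norm k` is the
norm of `M_k(V)` and `pos k` is the cone `M_k(V)⁺`. It is only used for the two concrete families of
spaces below (C⋆-algebras and preduals of von Neumann algebras). -/
structure MatrixNormOrder (V : Type*) where
  norm : ∀ k : ℕ, Matrix (Fin k) (Fin k) V → ℝ
  pos : ∀ k : ℕ, Set (Matrix (Fin k) (Fin k) V)

/-- The canonical matrix norms and matrix cones of a C⋆-algebra `A`: those of the C⋆-algebras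
`M_k(A)`. -/
def CStarAlgebra.matrixNormOrder (A : Type*) [CStarAlgebra A] [PartialOrder A]
    [StarOrderedRing A] : MatrixNormOrder A where
  norm _ v := ‖CStarMatrix.ofMatrix v‖
  pos _ := {v | 0 ≤ CStarMatrix.ofMatrix v}

/-! ### The tensor norms -/

section TensorNorms

variable {V W : Type*} [AddCommGroup V] [Module ℂ V] [AddCommGroup W] [Module ℂ W]

/-- The matrix `α x β` for scalar matrices `α`, `β` and a matrix `x` over a vector space. -/
def scalarSandwich {ι κ E : Type*} [Fintype κ] [AddCommGroup E] [Module ℂ E]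
    (α : Matrix ι κ ℂ) (x : Matrix κ κ E) (β : Matrix κ ι ℂ) : Matrix ι ι E :=
  Matrix.of fun i j => ∑ p, ∑ q, (α i p * β q j) • x p q

/-- The matrix `v ⊗ w ∈ M_{kl}(V ⊗ W)` for `v ∈ M_k(V)` and `w ∈ M_l(W)`. -/
def matrixTmul {k l : ℕ} (v : Matrix (Fin k) (Fin k) V) (w : Matrix (Fin l) (Fin l) W) :
    Matrix (Fin k × Fin l) (Fin k × Fin l) (V ⊗[ℂ] W) :=
  Matrix.kroneckerMap (fun a b => a ⊗ₜ[ℂ] b) v w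

/-- The operator space projective tensor norm
`‖z‖_∧ = inf {‖α‖ ‖v‖ ‖w‖ ‖β‖ : z = α (v ⊗ w) β}` on matrices over `V ⊗ W`. -/
def projectiveNorm (X : MatrixNormOrder V) (Y : MatrixNormOrder W) {ι : Type*} [Fintype ι]
    [DecidableEq ι] (z : Matrix ι ι (V ⊗[ℂ] W)) : ℝ :=
  sInf {c : ℝ | ∃ (k l : ℕ) (α : Matrix ι (Fin k × Fin l) ℂ) (v : Matrix (Fin k) (Fin k) V)
    (w : Matrix (Fin l) (Fin l) W) (β : Matrix (Fin k × Fin l) ι ℂ),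
    z = scalarSandwich α (matrixTmul v w) β ∧ c = ‖α‖ * X.norm k v * Y.norm l w * ‖β‖}

/-- The cone `M_ι(V ⊗_Δ W)_+` of all matrices `α (v ⊗ w) α*` with `v` and `w` positive. -/
def deltaCone (X : MatrixNormOrder V) (Y : MatrixNormOrder W) (ι : Type*) :
    Set (Matrix ι ι (V ⊗[ℂ] W)) :=
  {z | ∃ (k l : ℕ) (α : Matrix ι (Fin k × Fin l) ℂ), ∃ v ∈ X.pos k, ∃ w ∈ Y.pos l,
    z = scalarSandwich α (matrixTmul v w) α.conjTranspose}

/-- The scalar `|z|_Δ = inf {‖α‖² ‖v‖ ‖w‖ : z = α (v ⊗ w) α*, v ≥ 0, w ≥ 0}` attached to an element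
`z` of the cone `deltaCone`. -/
def deltaAbs (X : MatrixNormOrder V) (Y : MatrixNormOrder W) {ι : Type*} [Fintype ι]
    [DecidableEq ι] (z : Matrix ι ι (V ⊗[ℂ] W)) : ℝ :=
  sInf {c : ℝ | ∃ (k l : ℕ) (α : Matrix ι (Fin k × Fin l) ℂ), ∃ v ∈ X.pos k, ∃ w ∈ Y.pos l,
    z = scalarSandwich α (matrixTmul v w) α.conjTranspose ∧
    c = ‖α‖ ^ 2 * X.norm k v * Y.norm l w}

/-- The norm `‖z‖_Δ`: the infimum of `max {|u|_Δ, |u'|_Δ}` over all `u`, `u'` in the cone such that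
the block matrix `[u, z; z*, u']` lies in the cone. -/
def deltaNorm [StarAddMonoid V] [StarModule ℂ V] [StarAddMonoid W] [StarModule ℂ W]
    (X : MatrixNormOrder V) (Y : MatrixNormOrder W) {ι : Type*} [Fintype ι]
    [DecidableEq ι] (z : Matrix ι ι (V ⊗[ℂ] W)) : ℝ :=
  sInf {c : ℝ | ∃ u ∈ deltaCone X Y ι, ∃ u' ∈ deltaCone X Y ι,
    Matrix.fromBlocks u z z.conjTranspose u' ∈ deltaCone X Y (ι ⊕ ι) ∧
    c = max (deltaAbs X Y u) (deltaAbs X Y u')}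

end TensorNorms

/-! ### The predual of a von Neumann algebra -/

namespace VonNeumannAlgebra

variable {H : Type*} [NormedAddCommGroup H] [InnerProductSpace ℂ H] [CompleteSpace H]

/-- A linear functional on a von Neumann algebra is normal (σ-weakly continuous) if it is of the
form `x ↦ ∑ ⟨ξ_i, x η_i⟩` with `∑ ‖ξ_i‖² < ∞` and `∑ ‖η_i‖² < ∞`. -/
def IsNormalFunctional (R : VonNeumannAlgebra H) (φ : R.toStarSubalgebra →ₗ[ℂ] ℂ) : Prop :=
  ∃ ξ η : ℕ → H, Summable (fun i => ‖ξ i‖ ^ 2) ∧ Summable (fun i => ‖η i‖ ^ 2) ∧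
    ∀ x : R.toStarSubalgebra, HasSum (fun i => inner ℂ (ξ i) ((x : H →L[ℂ] H) (η i))) (φ x)

theorem IsNormalFunctional.add {R : VonNeumannAlgebra H} {φ ψ : R.toStarSubalgebra →ₗ[ℂ] ℂ}
    (hφ : R.IsNormalFunctional φ) (hψ : R.IsNormalFunctional ψ) :
    R.IsNormalFunctional (φ + ψ) := by
  obtain ⟨ξ, η, hξ, hη, h⟩ := hφ
  obtain ⟨ξ', η', hξ', hη', h'⟩ := hψ
  obtain ⟨e⟩ : Nonempty (ℕ ≃ ℕ ⊕ ℕ) := ⟨Equiv.natSumNatEquivNat.symm⟩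
  have hsum : ∀ (F : H → H → ℂ) (a b : ℂ), HasSum (fun i => F (ξ i) (η i)) a →
      HasSum (fun i => F (ξ' i) (η' i)) b →
      HasSum (fun i => F (Sum.elim ξ ξ' (e i)) (Sum.elim η η' (e i))) (a + b) := by
    intro F a b ha hb
    have hs : HasSum (fun s : ℕ ⊕ ℕ => F (Sum.elim ξ ξ' s) (Sum.elim η η' s)) (a + b) :=
      HasSum.sum (f := fun s : ℕ ⊕ ℕ => F (Sum.elim ξ ξ' s) (Sum.elim η η' s)) ha hb
    exact (e.hasSum_iff).2 hs
  have key : ∀ f g : ℕ → H, Summable (fun i => ‖f i‖ ^ 2) → Summable (fun i => ‖g i‖ ^ 2) →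
      Summable (fun i => ‖Sum.elim f g (e i)‖ ^ 2) := by
    intro f g hf hg
    have hs : Summable (fun s : ℕ ⊕ ℕ => ‖Sum.elim f g s‖ ^ 2) :=
      (HasSum.sum (f := fun s : ℕ ⊕ ℕ => ‖Sum.elim f g s‖ ^ 2) hf.hasSum hg.hasSum).summable
    exact hs.comp_injective e.injective
  exact ⟨fun i => Sum.elim ξ ξ' (e i),
    fun i => Sum.elim η η' (e i), key _ _ hξ hξ', key _ _ hη hη',
    fun x => hsum (fun a b => inner ℂ a ((x : H →L[ℂ] H) b)) _ _ (h x) (h' x)⟩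

theorem IsNormalFunctional.smul {R : VonNeumannAlgebra H} {φ : R.toStarSubalgebra →ₗ[ℂ] ℂ}
    (c : ℂ) (hφ : R.IsNormalFunctional φ) : R.IsNormalFunctional (c • φ) := by
  obtain ⟨ξ, η, hξ, hη, h⟩ := hφ
  refine ⟨ξ, fun i => c • η i, hξ, ?_, fun x => ?_⟩
  · simpa only [norm_smul, mul_pow] using hη.mul_left (‖c‖ ^ 2)
  · simpa only [map_smul, inner_smul_right, LinearMap.smul_apply, smul_eq_mul]
      using (h x).mul_left c

theorem isNormalFunctional_inner (R : VonNeumannAlgebra H) (φ : R.toStarSubalgebra →ₗ[ℂ] ℂ)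
    (ξ η : H) (h : ∀ x : R.toStarSubalgebra, φ x = inner ℂ ξ ((x : H →L[ℂ] H) η)) :
    R.IsNormalFunctional φ := by
  have hs : ∀ a : H, Summable (fun i : ℕ => ‖(Pi.single 0 a : ℕ → H) i‖ ^ 2) := fun a =>
    (hasSum_single 0 fun i hi => by simp [Pi.single_eq_of_ne hi]).summable
  refine ⟨Pi.single 0 ξ, Pi.single 0 η, hs ξ, hs η, fun x => ?_⟩
  have := hasSum_single (f := fun i : ℕ =>
    inner ℂ ((Pi.single 0 ξ : ℕ → H) i) ((x : H →L[ℂ] H) ((Pi.single 0 η : ℕ → H) i))) 0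
    (fun i hi => by simp [Pi.single_eq_of_ne hi])
  simpa [h x] using this

/-- The involution `φ*(x) = conj (φ(x*))` on linear functionals. -/
def starFunctional (R : VonNeumannAlgebra H) (φ : R.toStarSubalgebra →ₗ[ℂ] ℂ) :
    R.toStarSubalgebra →ₗ[ℂ] ℂ where
  toFun x := star (φ (star x))
  map_add' x y := by simp
  map_smul' c x := by simp

theorem IsNormalFunctional.star {R : VonNeumannAlgebra H} {φ : R.toStarSubalgebra →ₗ[ℂ] ℂ}
    (hφ : R.IsNormalFunctional φ) : R.IsNormalFunctional (R.starFunctional φ) := by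
  obtain ⟨ξ, η, hξ, hη, h⟩ := hφ
  refine ⟨η, ξ, hη, hξ, fun x => ?_⟩
  have := (h (Star.star x)).star
  change HasSum _ (Star.star (φ (Star.star x)))
  convert this using 2 with i
  rw [StarMemClass.coe_star, ContinuousLinearMap.star_eq_adjoint,
    ContinuousLinearMap.adjoint_inner_right]
  exact (inner_conj_symm _ _).symm

/-- The predual `R_*` of a von Neumann algebra `R`: the space of normal functionals on `R`. -/
def Predual (R : VonNeumannAlgebra H) : Submodule ℂ (R.toStarSubalgebra →ₗ[ℂ] ℂ) where
  carrier := {φ | R.IsNormalFunctional φ}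
  add_mem' := IsNormalFunctional.add
  zero_mem' := R.isNormalFunctional_inner 0 0 0 (by simp)
  smul_mem' c _ h := h.smul c

instance (R : VonNeumannAlgebra H) : StarAddMonoid R.Predual where
  star φ := ⟨R.starFunctional φ.1, IsNormalFunctional.star φ.2⟩
  star_involutive φ := by
    ext x
    simp [starFunctional]
  star_add φ ψ := by
    ext x
    simp [starFunctional]

instance (R : VonNeumannAlgebra H) : StarModule ℂ R.Predual where
  star_smul c φ := by
    ext x
    change star (c * φ.1 (star x)) = star c * star (φ.1 (star x))
    exact star_mul' c _

/-- The matrix `[φ_ij(x_ab)]`, the value at `x ∈ M_m(R)` of the `m`-th amplification of the map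
`R → M_k` given by a matrix `φ ∈ M_k(R_*)`. -/
def amplify (R : VonNeumannAlgebra H) {k m : ℕ} (φ : Matrix (Fin k) (Fin k) R.Predual)
    (x : Matrix (Fin m) (Fin m) R.toStarSubalgebra) :
    Matrix (Fin m × Fin k) (Fin m × Fin k) ℂ :=
  Matrix.of fun p q => (φ p.2 q.2).1 (x p.1 q.1)

/-- A matrix over `R`, seen in the C⋆-algebra `M_m(B(H))`. -/
def toOperatorMatrix (R : VonNeumannAlgebra H) {m : ℕ}
    (x : Matrix (Fin m) (Fin m) R.toStarSubalgebra) :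
    CStarMatrix (Fin m) (Fin m) (H →L[ℂ] H) :=
  CStarMatrix.ofMatrix (x.map fun a => (a : H →L[ℂ] H))

/-- The canonical matrix norms and matrix cones of the predual `R_*`: an element of `M_k(R_*)` is a
map `R → M_k`, its norm is the completely bounded norm of this map, and it is positive if this map
is completely positive. -/
def predualMatrixNormOrder (R : VonNeumannAlgebra H) : MatrixNormOrder R.Predual where
  norm _ φ := sSup {c : ℝ | ∃ (m : ℕ) (x : Matrix (Fin m) (Fin m) R.toStarSubalgebra),
    ‖R.toOperatorMatrix x‖ ≤ 1 ∧ c = ‖R.amplify φ x‖}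
  pos _ := {φ | ∀ (m : ℕ) (x : Matrix (Fin m) (Fin m) R.toStarSubalgebra),
    0 ≤ R.toOperatorMatrix x → (R.amplify φ x).PosSemidef}

/-- The von Neumann algebra generated by a set of operators: the double commutant of its
self-adjoint hull. -/
def generatedBy (S : Set (H →L[ℂ] H)) : VonNeumannAlgebra H where
  toStarSubalgebra := StarSubalgebra.centralizer ℂ (Set.centralizer (S ∪ star S))
  centralizer_centralizer' := by
    have hs : star (Set.centralizer (S ∪ star S)) = Set.centralizer (S ∪ star S) := by
      have h1 : ∀ y ∈ Set.centralizer (S ∪ star S), star y ∈ Set.centralizer (S ∪ star S) :=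
        fun y hy => (StarSubalgebra.centralizer ℂ S).star_mem' hy
      ext x
      refine ⟨fun hx => ?_, fun hx => h1 _ hx⟩
      have h2 := h1 _ (Set.mem_star.1 hx)
      rwa [star_star] at h2
    change Set.centralizer (Set.centralizer (Set.centralizer
      (Set.centralizer (S ∪ star S) ∪ star (Set.centralizer (S ∪ star S))))) =
      Set.centralizer (Set.centralizer (S ∪ star S) ∪ star (Set.centralizer (S ∪ star S)))
    rw [hs, Set.union_self, Set.centralizer_centralizer_centralizer]

theorem subset_generatedBy {S : Set (H →L[ℂ] H)} {x : H →L[ℂ] H} (hx : x ∈ S) :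
    x ∈ (generatedBy S).toStarSubalgebra := by
  change x ∈ Set.centralizer
    (Set.centralizer (S ∪ star S) ∪ star (Set.centralizer (S ∪ star S)))
  rintro y (hy | hy)
  · exact (hy x (Or.inl hx)).symm
  · have h := hy (star x) (Or.inr (Set.star_mem_star.2 hx))
    have h2 := congrArg star h
    simpa only [star_mul, star_star] using h2

end VonNeumannAlgebra

/-! ### The von Neumann algebra of a discrete group -/

section GroupVonNeumannAlgebra

variable {G : Type*} [Group G]

/-- The left regular representation on `ℓ²(G)`, `(λ(g) ξ)(h) = ξ(g⁻¹ h)`. -/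
def leftRegular (g : G) : lp (fun _ : G => ℂ) 2 →L[ℂ] lp (fun _ : G => ℂ) 2 :=
  LinearIsometry.toContinuousLinearMap
    { toFun := fun ξ => ⟨fun h => ξ (g⁻¹ * h), by
        have h2 : (0 : ℝ) < (2 : ENNReal).toReal := by norm_num
        exact memℓp_gen (((lp.memℓp ξ).summable h2).comp_injective
          (mul_right_injective g⁻¹))⟩
      map_add' := fun _ _ => rfl
      map_smul' := fun _ _ => rfl
      norm_map' := fun ξ => by
        have h2 : (0 : ℝ) < (2 : ENNReal).toReal := by norm_num
        rw [lp.norm_eq_tsum_rpow h2, lp.norm_eq_tsum_rpow h2]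
        congr 1
        exact (Equiv.mulLeft g⁻¹).tsum_eq fun h => ‖ξ h‖ ^ (2 : ENNReal).toReal }

variable (G) in
/-- The group von Neumann algebra `L(G)`, generated by the operators `λ(g)`. -/
def groupVonNeumannAlgebra : VonNeumannAlgebra (lp (fun _ : G => ℂ) 2) :=
  VonNeumannAlgebra.generatedBy (Set.range (leftRegular (G := G)))

/-- The operator `λ(g)` as an element of `L(G)`. -/
def groupUnitary (g : G) : (groupVonNeumannAlgebra G).toStarSubalgebra :=
  ⟨leftRegular g, VonNeumannAlgebra.subset_generatedBy ⟨g, rfl⟩⟩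

open Classical in
variable (G) in
/-- The unit vector `δ_e` of `ℓ²(G)`. -/
def groupVacuum : lp (fun _ : G => ℂ) 2 := lp.single 2 (1 : G) (1 : ℂ)

/-- The operator on `ℓ²(G)` underlying an element of `L(G)`. -/
abbrev groupOperator (x : (groupVonNeumannAlgebra G).toStarSubalgebra) :
    lp (fun _ : G => ℂ) 2 →L[ℂ] lp (fun _ : G => ℂ) 2 := x

variable (G) in
/-- The canonical trace `tr(x) = ⟨δ_e, x δ_e⟩` of `L(G)`. -/
def groupTrace : (groupVonNeumannAlgebra G).toStarSubalgebra →ₗ[ℂ] ℂ where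
  toFun x := inner ℂ (groupVacuum G) (groupOperator x (groupVacuum G))
  map_add' x y := inner_add_right (groupVacuum G) (groupOperator x (groupVacuum G))
    (groupOperator y (groupVacuum G))
  map_smul' c x := inner_smul_right (groupVacuum G) (groupOperator x (groupVacuum G)) c

/-- The embedding `L(G) → L(G)_*`, `x ↦ tr(· x)`. -/
def tracePredual (x : (groupVonNeumannAlgebra G).toStarSubalgebra) :
    (groupVonNeumannAlgebra G).Predual :=
  ⟨groupTrace G ∘ₗ LinearMap.mulRight ℂ x,
    VonNeumannAlgebra.isNormalFunctional_inner _ _ (groupVacuum G)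
      (groupOperator x (groupVacuum G)) fun _ => rfl⟩

end GroupVonNeumannAlgebra

/-- The element `∑ e_k ⊗ λ(g_k)` of `ℓ_∞^n ⊗ L(F_n)_*`, where `g_1, …, g_n` are the generators of
the free group `F_n` and `L(F_n)` is embedded into its predual by the trace. It is regarded as
a `1 × 1` matrix. -/
def freeGeneratorTensor (n : ℕ) :
    Matrix (Fin 1) (Fin 1)
      ((Fin n → ℂ) ⊗[ℂ] (groupVonNeumannAlgebra (FreeGroup (Fin n))).Predual) :=
  Matrix.of fun _ _ => ∑ k : Fin n,
    (Pi.single k 1 : Fin n → ℂ) ⊗ₜ[ℂ] tracePredual (groupUnitary (FreeGroup.of k))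

end

/-! Write `δ` for the vacuum vector. Since `tr(x λ(g)) = ⟨δ, x λ(g)δ⟩`, the tensor is `∑ e_k ⊗ ω(δ,
λ(g_k)δ)` with `ω(ξ, η)` the vector functional `x ↦ ⟨ξ, x η⟩`.

Delta norm. The functionals `ω(ζ_i, ζ_j)` for `ζ = (δ, λ(g_1)δ, …, λ(g_n)δ)` form a positive matrix
over the predual, by a Gram matrix argument. Every diagonal entry is the trace, because `λ(g)δ` is a
right translate of `δ` and right translations are isometries commuting with `L(G)`. Hence the tensor
is the corner of a block in the cone whose diagonal entries are `1 ⊗ tr`, of size at most 1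
(`fromBlocks_basisTensor_mem`). Conversely, pairing such a block at one coordinate with a positive
`2 × 2` matrix built from a unitary forces the diagonal to have size at least 1
(`one_le_max_deltaAbs`).

Projective norm. By duality it suffices to pair with `T : e_k ↦ λ(g_k)*`: the pairing is `n`, and
the completely bounded norm of `T` is at most `2√(n-1)`. The latter is a weighted Schur test on the
Cayley tree (`exists_hasSum_free_generators`), applied to matrix coefficients in
`norm_toOperatorMatrix_freeGeneratorMap_le`. -/

/-! ### Matrices of operators acting on `H^m`, and scalar matrices as forms -/

/-- The vector `(a_p ξ)_p` of `H^m`. -/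
noncomputable def smulVector {H : Type*} [NormedAddCommGroup H] [InnerProductSpace ℂ H] {m : ℕ}
    (a : Fin m → ℂ) (ξ : H) : PiLp 2 (fun _ : Fin m => H) :=
  WithLp.toLp 2 fun p => a p • ξ

theorem norm_smulVector {H : Type*} [NormedAddCommGroup H] [InnerProductSpace ℂ H] {m : ℕ}
    (a : EuclideanSpace ℂ (Fin m)) (ξ : H) :
    ‖smulVector a ξ‖ = ‖a‖ * ‖ξ‖ := by
  rw [EuclideanSpace.norm_eq, PiLp.norm_eq_of_L2]
  simp only [smulVector, norm_smul, mul_pow]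
  rw [← Finset.sum_mul, Real.sqrt_mul (by positivity), Real.sqrt_sq (norm_nonneg _)]

section
variable {H : Type*} [NormedAddCommGroup H] [InnerProductSpace ℂ H] [CompleteSpace H]

/-- The operator on `H^m` given by an `m × m` matrix of operators on `H`. -/
noncomputable def operatorMatrixHom (H : Type*) [NormedAddCommGroup H]
    [InnerProductSpace ℂ H] [CompleteSpace H] (m : ℕ) :
    CStarMatrix (Fin m) (Fin m) (H →L[ℂ] H) →⋆ₙₐ[ℂ]
      (PiLp 2 (fun _ : Fin m => H) →L[ℂ] PiLp 2 (fun _ : Fin m => H)) where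
  toFun M := (PiLp.continuousLinearEquiv 2 ℂ (fun _ : Fin m => H)).symm.toContinuousLinearMap ∘L
    (ContinuousLinearMap.pi fun p => ∑ q, M p q ∘L ContinuousLinearMap.proj q) ∘L
      (PiLp.continuousLinearEquiv 2 ℂ (fun _ : Fin m => H)).toContinuousLinearMap
  map_smul' c M := by
    ext ξ p
    simp [Finset.smul_sum]
  map_zero' := by
    ext ξ p
    simp
  map_add' M N := by
    ext ξ p
    simp [Finset.sum_add_distrib]
  map_mul' M N := by
    ext ξ p
    simp [CStarMatrix.mul_apply]
    rw [Finset.sum_comm]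
  map_star' M := by
    rw [ContinuousLinearMap.star_eq_adjoint, ContinuousLinearMap.eq_adjoint_iff]
    intro ξ η
    simp [PiLp.inner_apply, sum_inner, inner_sum, CStarMatrix.star_apply, ContinuousLinearMap.star_eq_adjoint, ContinuousLinearMap.adjoint_inner_left]
    rw [Finset.sum_comm]

theorem operatorMatrixHom_apply {m : ℕ} (M : CStarMatrix (Fin m) (Fin m) (H →L[ℂ] H))
    (ξ : PiLp 2 (fun _ : Fin m => H)) (p : Fin m) :
    operatorMatrixHom H m M ξ p = ∑ q, M p q (ξ q) := by
  simp [operatorMatrixHom]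

theorem operatorMatrixHom_injective (m : ℕ) : Function.Injective (operatorMatrixHom H m) := by
  rw [injective_iff_map_eq_zero]
  intro M hM
  ext p q v
  have h := congrArg (fun T => T (PiLp.single 2 q v) p) hM
  simpa [operatorMatrixHom_apply, PiLp.single_apply, apply_ite] using h

/-- An injective `*`-homomorphism of C⋆-algebras is isometric, so norms in `M_m(B(H))` can be
estimated on vectors of `H^m`. -/
theorem norm_operatorMatrixHom {m : ℕ} (M : CStarMatrix (Fin m) (Fin m) (H →L[ℂ] H)) :
    ‖operatorMatrixHom H m M‖ = ‖M‖ :=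
  NonUnitalStarAlgHom.norm_map _ (operatorMatrixHom_injective m) M

theorem inner_operatorMatrixHom {m : ℕ} (M : CStarMatrix (Fin m) (Fin m) (H →L[ℂ] H))
    (ξ η : PiLp 2 (fun _ : Fin m => H)) :
    inner ℂ ξ (operatorMatrixHom H m M η) = ∑ p, ∑ q, inner ℂ (ξ p) (M p q (η q)) := by
  simp [PiLp.inner_apply, operatorMatrixHom_apply, inner_sum]

/-- The sum is a matrix coefficient of `M` at the elementary tensors `a ⊗ ξ` and `b ⊗ η`. The
constant is independent of `m`, which makes vector functionals completely bounded. -/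
theorem norm_sum_inner_le {m : ℕ} (M : CStarMatrix (Fin m) (Fin m) (H →L[ℂ] H))
    (a b : EuclideanSpace ℂ (Fin m)) (ξ η : H) :
    ‖∑ p, ∑ q, star (a p) * b q * inner ℂ ξ (M p q η)‖ ≤
      ‖M‖ * (‖a‖ * ‖b‖) * (‖ξ‖ * ‖η‖) := by
  have h : ∑ p, ∑ q, star (a p) * b q * inner ℂ ξ (M p q η) =
      inner ℂ (smulVector a ξ) (operatorMatrixHom H m M (smulVector b η)) := by
    rw [inner_operatorMatrixHom]
    refine Finset.sum_congr rfl fun p _ => Finset.sum_congr rfl fun q _ => ?_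
    simp only [smulVector, map_smul, inner_smul_left, inner_smul_right, starRingEnd_apply]
    ring
  rw [h]
  refine (norm_inner_le_norm _ _).trans ?_
  refine (mul_le_mul_of_nonneg_left ((operatorMatrixHom H m M).le_opNorm _)
    (norm_nonneg _)).trans (le_of_eq ?_)
  rw [norm_operatorMatrixHom, norm_smulVector, norm_smulVector]
  ring

end

theorem Matrix.l2_opNorm_le_of_forall {κ κ' : Type*} [Fintype κ] [Fintype κ'] [DecidableEq κ']
    (M : Matrix κ κ' ℂ) {C : ℝ} (hC : 0 ≤ C)
    (h : ∀ (a : EuclideanSpace ℂ κ) (b : EuclideanSpace ℂ κ'),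
      ‖∑ p, ∑ q, star (a p) * b q * M p q‖ ≤ C * (‖a‖ * ‖b‖)) : ‖M‖ ≤ C := by
  rw [Matrix.l2_opNorm_def]
  refine ContinuousLinearMap.opNorm_le_of_re_inner_le (𝕜 := ℂ) hC fun b a hb ha => ?_
  have h1 := h a b
  rw [ha, hb, mul_one, mul_one] at h1
  refine le_trans ?_ h1
  have h2 : inner ℂ (((Matrix.toEuclideanLin (𝕜 := ℂ) ≪≫ₗ LinearMap.toContinuousLinearMap) M) b) a =
      star (∑ p, ∑ q, star (a p) * b q * M p q) := by
    simp [PiLp.inner_apply, Matrix.toEuclideanLin, Matrix.mulVec, dotProduct, Finset.mul_sum]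
    refine Finset.sum_congr rfl fun p _ => Finset.sum_congr rfl fun q _ => by ring
  rw [h2]
  exact Complex.re_le_norm _

theorem Matrix.norm_sum_sum_le_l2_opNorm {κ κ' : Type*} [Fintype κ] [Fintype κ'] [DecidableEq κ']
    (M : Matrix κ κ' ℂ) (a : EuclideanSpace ℂ κ) (b : EuclideanSpace ℂ κ') :
    ‖∑ p, ∑ q, star (a p) * b q * M p q‖ ≤ ‖M‖ * (‖a‖ * ‖b‖) := by
  have h : ∑ p, ∑ q, star (a p) * b q * M p q =
      inner ℂ a (WithLp.toLp 2 (M.mulVec b)) := by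
    simp only [PiLp.inner_apply, Matrix.mulVec, dotProduct, RCLike.inner_apply, Finset.sum_mul]
    refine Finset.sum_congr rfl fun p _ => Finset.sum_congr rfl fun q _ => ?_
    rw [starRingEnd_apply]
    ring
  rw [h]
  refine (norm_inner_le_norm _ _).trans ?_
  refine (mul_le_mul_of_nonneg_left (Matrix.l2_opNorm_mulVec M b) (norm_nonneg a)).trans
    (le_of_eq (by ring))

theorem Matrix.norm_apply_le_l2_opNorm {κ κ' : Type*} [Fintype κ] [Fintype κ'] [DecidableEq κ']
    (M : Matrix κ κ' ℂ) (p : κ) (q : κ') : ‖M p q‖ ≤ ‖M‖ := by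
  have h := Matrix.l2_opNorm_mulVec M (EuclideanSpace.single q 1)
  rw [PiLp.norm_single, norm_one, mul_one] at h
  refine le_trans ?_ h
  refine le_trans (le_of_eq ?_) (PiLp.norm_apply_le _ p)
  simp

/-! ### Completely bounded norms on the predual -/

namespace VonNeumannAlgebra
variable {H : Type*} [NormedAddCommGroup H] [InnerProductSpace ℂ H] [CompleteSpace H]

theorem predual_norm_nonneg (R : VonNeumannAlgebra H) {l : ℕ}
    (w : Matrix (Fin l) (Fin l) R.Predual) : 0 ≤ R.predualMatrixNormOrder.norm l w :=
  Real.sSup_nonneg (by rintro _ ⟨m, x, -, rfl⟩; exact norm_nonneg _)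

theorem norm_slice_le {m k : ℕ} (a : EuclideanSpace ℂ (Fin m × Fin k)) (i : Fin k) :
    ‖WithLp.toLp 2 fun p : Fin m => a (p, i)‖ ≤ ‖a‖ := by
  rw [EuclideanSpace.norm_eq, EuclideanSpace.norm_eq]
  refine Real.sqrt_le_sqrt ?_
  rw [Fintype.sum_prod_type]
  exact Finset.sum_le_sum fun p _ =>
    Finset.single_le_sum (f := fun j => ‖a (p, j)‖ ^ 2) (fun _ _ => by positivity)
      (Finset.mem_univ i)

/-- A normal functional is completely bounded. -/
theorem exists_bound_of_isNormalFunctional {R : VonNeumannAlgebra H}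
    {φ : R.toStarSubalgebra →ₗ[ℂ] ℂ} (hφ : R.IsNormalFunctional φ) :
    ∃ C : ℝ, 0 ≤ C ∧ ∀ (m : ℕ) (x : Matrix (Fin m) (Fin m) R.toStarSubalgebra)
      (a b : EuclideanSpace ℂ (Fin m)),
      ‖∑ p, ∑ q, star (a p) * b q * φ (x p q)‖ ≤ C * (‖R.toOperatorMatrix x‖ * (‖a‖ * ‖b‖)) := by
  obtain ⟨ξ, η, hξ, hη, h⟩ := hφ
  have hs : Summable fun i => ‖ξ i‖ * ‖η i‖ :=
    (hξ.add hη).of_nonneg_of_le (fun i => by positivity) fun i => by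
      nlinarith [sq_nonneg (‖ξ i‖ - ‖η i‖), sq_nonneg (‖ξ i‖), sq_nonneg (‖η i‖)]
  refine ⟨∑' i, ‖ξ i‖ * ‖η i‖, tsum_nonneg fun i => by positivity, fun m x a b => ?_⟩
  have h1 : HasSum (fun i => ∑ p, ∑ q, star (a p) * b q *
      inner ℂ (ξ i) ((x p q : H →L[ℂ] H) (η i))) (∑ p, ∑ q, star (a p) * b q * φ (x p q)) :=
    hasSum_sum fun p _ => hasSum_sum fun q _ => (h (x p q)).mul_left _
  have h2 := hs.hasSum.mul_left (‖R.toOperatorMatrix x‖ * (‖a‖ * ‖b‖))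
  rw [← h1.tsum_eq, mul_comm]
  exact tsum_of_norm_bounded h2 fun i => norm_sum_inner_le (R.toOperatorMatrix x) a b (ξ i) (η i)

theorem sum_amplify (R : VonNeumannAlgebra H) {l m : ℕ} (w : Matrix (Fin l) (Fin l) R.Predual)
    (x : Matrix (Fin m) (Fin m) R.toStarSubalgebra) (a b : Fin m × Fin l → ℂ) :
    ∑ P, ∑ Q, star (a P) * b Q * R.amplify w x P Q =
      ∑ i, ∑ j, ∑ p, ∑ q, star (a (p, i)) * b (q, j) * (w i j).1 (x p q) := by
  simp only [Fintype.sum_prod_type, amplify, Matrix.of_apply]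
  rw [Finset.sum_comm]
  refine Finset.sum_congr rfl fun i _ => ?_
  rw [Finset.sum_congr rfl fun p _ => Finset.sum_comm, Finset.sum_comm]

/-- Without boundedness the supremum defining the predual norm would take the default value `0` and
dominate nothing. -/
theorem bddAbove_predual_norm (R : VonNeumannAlgebra H) {l : ℕ}
    (w : Matrix (Fin l) (Fin l) R.Predual) :
    BddAbove {c : ℝ | ∃ (m : ℕ) (x : Matrix (Fin m) (Fin m) R.toStarSubalgebra),
      ‖R.toOperatorMatrix x‖ ≤ 1 ∧ c = ‖R.amplify w x‖} := by
  choose C hC0 hC using fun i j => exists_bound_of_isNormalFunctional (w i j).2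
  refine ⟨∑ i, ∑ j, C i j, ?_⟩
  rintro _ ⟨m, x, hx, rfl⟩
  refine Matrix.l2_opNorm_le_of_forall _
    (Finset.sum_nonneg fun i _ => Finset.sum_nonneg fun j _ => hC0 i j) fun a b => ?_
  rw [sum_amplify, Finset.sum_mul]
  refine norm_sum_le_of_le _ fun i _ => ?_
  rw [Finset.sum_mul]
  refine norm_sum_le_of_le _ fun j _ => ?_
  refine (hC i j m x (WithLp.toLp 2 fun p => a (p, i)) (WithLp.toLp 2 fun q => b (q, j))).trans ?_
  refine mul_le_mul_of_nonneg_left ?_ (hC0 i j)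
  calc _ ≤ 1 * (‖a‖ * ‖b‖) := by
        gcongr
        · exact norm_slice_le a i
        · exact norm_slice_le b j
    _ = _ := one_mul _

theorem norm_amplify_le (R : VonNeumannAlgebra H) {l m : ℕ}
    (w : Matrix (Fin l) (Fin l) R.Predual) (x : Matrix (Fin m) (Fin m) R.toStarSubalgebra)
    {C : ℝ} (hx : ‖R.toOperatorMatrix x‖ ≤ C) :
    ‖R.amplify w x‖ ≤ C * R.predualMatrixNormOrder.norm l w := by
  have key : ∀ D : ℝ, 0 < D → ‖R.toOperatorMatrix x‖ ≤ D →
      ‖R.amplify w x‖ ≤ D * R.predualMatrixNormOrder.norm l w := by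
    intro D hD hxD
    have hsm : R.toOperatorMatrix (((D : ℂ)⁻¹) • x) = ((D : ℂ)⁻¹) • R.toOperatorMatrix x := rfl
    have h1 : ‖R.toOperatorMatrix (((D : ℂ)⁻¹) • x)‖ ≤ 1 := by
      rw [hsm, norm_smul, norm_inv, Complex.norm_real, Real.norm_of_nonneg hD.le]
      rw [inv_mul_le_iff₀ hD, mul_one]
      exact hxD
    have h2 : ‖R.amplify w (((D : ℂ)⁻¹) • x)‖ ≤ R.predualMatrixNormOrder.norm l w :=
      le_csSup (R.bddAbove_predual_norm w) ⟨m, _, h1, rfl⟩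
    have h3 : R.amplify w (((D : ℂ)⁻¹) • x) = ((D : ℂ)⁻¹) • R.amplify w x := by
      ext P Q
      simp [amplify]
    rw [h3, norm_smul, norm_inv, Complex.norm_real, Real.norm_of_nonneg hD.le,
      inv_mul_le_iff₀ hD] at h2
    exact h2
  have h0 := R.predual_norm_nonneg w
  refine le_of_forall_pos_le_add fun ε hε => ?_
  -- Rescaling needs a positive bound, but `C` may be `0`; it is enlarged by an amount costing at
  -- most `ε`. The `+ 1` covers the case of norm zero.
  have hd : 0 < ε / (R.predualMatrixNormOrder.norm l w + 1) := by positivity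
  refine (key (C + ε / (R.predualMatrixNormOrder.norm l w + 1)) ?_ (by linarith)).trans ?_
  · linarith [norm_nonneg (R.toOperatorMatrix x)]
  · rw [add_mul]
    gcongr
    rw [div_mul_eq_mul_div, div_le_iff₀ (by positivity)]
    nlinarith

end VonNeumannAlgebra

/-! ### Pairing `V ⊗ R_*` with maps `V → R` -/

namespace VonNeumannAlgebra
variable {H : Type*} [NormedAddCommGroup H] [InnerProductSpace ℂ H] [CompleteSpace H]
  {V : Type*} [AddCommGroup V] [Module ℂ V]

/-- The functional `v ⊗ φ ↦ φ (T v)` on `V ⊗ R_*` given by a linear map `T : V → R`. -/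
noncomputable def dualPairing (R : VonNeumannAlgebra H) (T : V →ₗ[ℂ] R.toStarSubalgebra) :
    V ⊗[ℂ] R.Predual →ₗ[ℂ] ℂ :=
  TensorProduct.lift (LinearMap.mk₂ ℂ (fun v φ => φ.1 (T v)) (by simp) (by simp) (by simp)
    (by simp))

theorem dualPairing_tmul (R : VonNeumannAlgebra H) (T : V →ₗ[ℂ] R.toStarSubalgebra) (v : V)
    (φ : R.Predual) : R.dualPairing T (v ⊗ₜ φ) = φ.1 (T v) := by
  simp [dualPairing]

/-- The pairing turns a representation `α (v ⊗ w) β` into a product of scalar matrices, whose norm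
is then controlled factor by factor. -/
theorem dualPairing_scalarSandwich (R : VonNeumannAlgebra H) (T : V →ₗ[ℂ] R.toStarSubalgebra)
    {ι : Type*} {k l : ℕ} (α : Matrix ι (Fin k × Fin l) ℂ) (v : Matrix (Fin k) (Fin k) V)
    (w : Matrix (Fin l) (Fin l) R.Predual) (β : Matrix (Fin k × Fin l) ι ℂ) (i j : ι) :
    R.dualPairing T (scalarSandwich α (matrixTmul v w) β i j) =
      (α * R.amplify w (v.map T) * β) i j := by
  simp only [scalarSandwich, matrixTmul, Matrix.of_apply, map_sum, map_smul, Matrix.kroneckerMap,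
    dualPairing_tmul, Matrix.mul_apply, amplify, Matrix.map_apply, Finset.sum_mul, smul_eq_mul]
  rw [Finset.sum_comm]
  exact Finset.sum_congr rfl fun q _ => Finset.sum_congr rfl fun p _ => by ring

theorem norm_dualPairing_scalarSandwich_le (R : VonNeumannAlgebra H)
    (T : V →ₗ[ℂ] R.toStarSubalgebra) {ι : Type*} [Fintype ι] [DecidableEq ι] {k l : ℕ}
    {z : Matrix ι ι (V ⊗[ℂ] R.Predual)} {α : Matrix ι (Fin k × Fin l) ℂ}
    {v : Matrix (Fin k) (Fin k) V} {w : Matrix (Fin l) (Fin l) R.Predual}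
    {β : Matrix (Fin k × Fin l) ι ℂ} (hz : z = scalarSandwich α (matrixTmul v w) β) {C : ℝ}
    (hC : ‖R.toOperatorMatrix (v.map T)‖ ≤ C) (i j : ι) :
    ‖R.dualPairing T (z i j)‖ ≤ ‖α‖ * C * R.predualMatrixNormOrder.norm l w * ‖β‖ := by
  rw [hz, dualPairing_scalarSandwich]
  refine (Matrix.norm_apply_le_l2_opNorm _ i j).trans ?_
  refine (Matrix.l2_opNorm_mul _ _).trans ?_
  refine mul_le_mul_of_nonneg_right ?_ (norm_nonneg β)
  refine (Matrix.l2_opNorm_mul _ _).trans ?_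
  rw [mul_assoc]
  exact mul_le_mul_of_nonneg_left (R.norm_amplify_le w _ hC) (norm_nonneg α)

end VonNeumannAlgebra

/-! ### Coordinate evaluations on `ℓ_∞^n` -/

/-- Evaluation of a matrix over `ℓ_∞^n` at a coordinate. -/
noncomputable def matrixEval {n : ℕ} (m : ℕ) (i : Fin n) :
    CStarMatrix (Fin m) (Fin m) (Fin n → ℂ) →⋆ₙₐ[ℂ] Matrix (Fin m) (Fin m) ℂ where
  toFun M := Matrix.of fun p q => M p q i
  map_smul' _ _ := rfl
  map_zero' := rfl
  map_add' _ _ := rfl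
  map_mul' M N := by
    ext p q
    simp [CStarMatrix.mul_apply, Matrix.mul_apply]
  map_star' _ := rfl

theorem norm_matrixEval_le {n m : ℕ} (i : Fin n) (v : CStarMatrix (Fin m) (Fin m) (Fin n → ℂ)) :
    ‖matrixEval m i v‖ ≤ ‖v‖ :=
  NonUnitalStarAlgHom.norm_apply_le _ v

/-- The homomorphism `f ↦ f(i) 1` from `ℓ_∞^n` to `B(H)`. -/
noncomputable def evalScalar (H : Type*) [NormedAddCommGroup H] [InnerProductSpace ℂ H]
    [CompleteSpace H] {n : ℕ} (i : Fin n) : (Fin n → ℂ) →⋆ₙₐ[ℂ] (H →L[ℂ] H) where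
  toFun f := f i • 1
  map_smul' c f := by simp [mul_smul]
  map_zero' := by simp
  map_add' f g := by simp [add_smul]
  map_mul' f g := by simp [smul_smul, mul_comm]
  map_star' f := by simp

namespace VonNeumannAlgebra
variable {H : Type*} [NormedAddCommGroup H] [InnerProductSpace ℂ H] [CompleteSpace H]

/-- The map `f ↦ f(i) y` from `ℓ_∞^n` to `R`. -/
noncomputable def evalSmul (R : VonNeumannAlgebra H) {n : ℕ} (i : Fin n) (y : R.toStarSubalgebra) :
    (Fin n → ℂ) →ₗ[ℂ] R.toStarSubalgebra :=
  (LinearMap.proj i : (Fin n → ℂ) →ₗ[ℂ] ℂ).smulRight y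

/-- The map `f ↦ f(i) 1` is a `*`-homomorphism, so all its amplifications are too, and these are
contractive. -/
theorem norm_toOperatorMatrix_evalSmul_one_le (R : VonNeumannAlgebra H) {n m : ℕ} (i : Fin n)
    (v : Matrix (Fin m) (Fin m) (Fin n → ℂ)) :
    ‖R.toOperatorMatrix (v.map (R.evalSmul i 1))‖ ≤ ‖CStarMatrix.ofMatrix v‖ := by
  have h : R.toOperatorMatrix (v.map (R.evalSmul i 1)) =
      CStarMatrix.mapₙₐ (evalScalar H i) (CStarMatrix.ofMatrix v) := rfl
  rw [h]
  exact NonUnitalStarAlgHom.norm_apply_le _ _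

end VonNeumannAlgebra

/-! ### The weighted Schur test on the Cayley tree -/

/-- Multiplying by `g_k` on the left either prepends that letter or cancels an initial `g_k⁻¹`;
after a cancellation the next letter cannot be `g_k`, since the word was reduced. -/
theorem FreeGroup.head?_toWord_of_mul {n : ℕ} (k : Fin n) (h : FreeGroup (Fin n)) :
    (FreeGroup.of k * h).toWord.head? = some (k, true) ↔
      ¬ h.toWord.head? = some (k, false) := by
  have hw : (FreeGroup.of k * h).toWord = FreeGroup.reduce ((k, true) :: h.toWord) := by
    rw [FreeGroup.toWord_mul, FreeGroup.toWord_of]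
    rfl
  have hred := FreeGroup.isReduced_toWord (x := h)
  rw [hw, FreeGroup.reduce.cons, FreeGroup.reduce_toWord]
  revert hred
  cases h.toWord with
  | nil => simp
  | cons a tl =>
    obtain ⟨i, b⟩ := a
    intro hred
    by_cases hc : k = i ∧ b = false
    · obtain ⟨rfl, rfl⟩ := hc
      cases tl with
      | nil => simp
      | cons a' tl' =>
        rw [FreeGroup.isReduced_cons_cons] at hred
        obtain ⟨i', b'⟩ := a'
        simp
        rintro rfl
        simpa using hred.1
    · have hc' : ¬ (i = k ∧ b = false) := fun h' => hc ⟨h'.1.symm, h'.2⟩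
      simp [hc, hc']

/-- The weight `c` at words beginning with the letter `(k, b)`, and `1 / c` elsewhere. -/
noncomputable def letterWeight {n : ℕ} (c : ℝ) (b : Bool) (k : Fin n) (h : FreeGroup (Fin n)) : ℝ :=
  if h.toWord.head? = some (k, b) then c else c⁻¹

theorem letterWeight_pos {n : ℕ} {c : ℝ} (hc : 0 < c) (b : Bool) (k : Fin n)
    (h : FreeGroup (Fin n)) : 0 < letterWeight c b k h := by
  unfold letterWeight
  split_ifs
  · exact hc
  · exact inv_pos.2 hc

/-- Exactly one of the two events occurs on each edge from `h` to `g_k h`, so the weights at its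
ends are inverse to each other, as the Schur test requires. -/
theorem letterWeight_of_mul {n : ℕ} (c : ℝ) (k : Fin n) (h : FreeGroup (Fin n)) :
    letterWeight c true k (FreeGroup.of k * h) = (letterWeight c false k h)⁻¹ := by
  unfold letterWeight
  by_cases hh : h.toWord.head? = some (k, false)
  · rw [if_pos hh, if_neg (by rw [FreeGroup.head?_toWord_of_mul]; exact not_not.2 hh)]
  · rw [if_neg hh, if_pos ((FreeGroup.head?_toWord_of_mul k h).2 hh), inv_inv]

/-- A word has one first letter, so at most one weight is `c` and the others are `1 / c`. The sum is
then `c + (n - 1) / c`, minimised at `c = √(n - 1)` with value `2c`; if no weight is `c`, the sum `n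
/ c` is smaller or equal because `c ≥ 1`. -/
theorem sum_letterWeight_le {n : ℕ} (hn : 2 ≤ n) (b : Bool) (h : FreeGroup (Fin n)) :
    ∑ k, letterWeight (√((n : ℝ) - 1)) b k h ≤ 2 * √((n : ℝ) - 1) := by
  have hn' : (2 : ℝ) ≤ n := by exact_mod_cast hn
  set c := √((n : ℝ) - 1) with hc
  have hsq : c * c = n - 1 := Real.mul_self_sqrt (by linarith)
  have hc1 : 1 ≤ c := by
    rw [hc, Real.one_le_sqrt]
    linarith
  have hc0 : 0 < c := by linarith
  have hinv : c⁻¹ ≤ c := (inv_le_one_of_one_le₀ hc1).trans hc1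
  have hcc : (n : ℝ) * c⁻¹ + (c - c⁻¹) = 2 * c := by
    field_simp
    nlinarith
  have h1 : ∀ k : Fin n, letterWeight c b k h =
      c⁻¹ + if h.toWord.head? = some (k, b) then c - c⁻¹ else 0 := by
    intro k
    unfold letterWeight
    split_ifs <;> ring
  rw [Finset.sum_congr rfl fun k _ => h1 k, Finset.sum_add_distrib, Finset.sum_const,
    Finset.card_univ, Fintype.card_fin, nsmul_eq_mul, ← hcc]
  refine add_le_add le_rfl ?_
  by_cases hk : ∃ k₀ : Fin n, h.toWord.head? = some (k₀, b)
  · obtain ⟨k₀, hk₀⟩ := hk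
    rw [Finset.sum_eq_single k₀]
    · split_ifs
      linarith
    · intro k _ hne
      rw [if_neg]
      rw [hk₀]
      simpa using hne.symm
    · simp
  · push Not at hk
    rw [Finset.sum_eq_zero fun k _ => if_neg (hk k)]
    linarith

theorem mul_le_weighted_add_sq_div_two {s a b : ℝ} (hs : 0 < s) :
    a * b ≤ (s * a ^ 2 + s⁻¹ * b ^ 2) / 2 := by
  have h : (s * a ^ 2 + s⁻¹ * b ^ 2) / 2 - a * b = s⁻¹ * (s * a - b) ^ 2 / 2 := by
    field_simp
    ring
  have : 0 ≤ s⁻¹ * (s * a - b) ^ 2 / 2 := by positivity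
  linarith

/-- The tree estimate: a dominating series for `∑ₕ ∑ₖ a(h) b(gₖ h)`. -/
theorem exists_hasSum_free_generators {n : ℕ} (hn : 2 ≤ n) (a b : FreeGroup (Fin n) → ℝ) {A B : ℝ}
    (ha : HasSum (fun h => a h ^ 2) A) (hb : HasSum (fun h => b h ^ 2) B) :
    ∃ (F : FreeGroup (Fin n) → ℝ) (S : ℝ), HasSum F S ∧ S ≤ √((n : ℝ) - 1) * (A + B) ∧
      ∀ h, ∑ k, a h * b (FreeGroup.of k * h) ≤ F h := by
  have hn' : (2 : ℝ) ≤ n := by exact_mod_cast hn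
  set c := √((n : ℝ) - 1) with hc
  have hc0 : 0 < c := Real.sqrt_pos.2 (by linarith)
  -- Summing over `k` at a fixed word first lets the bound on the total weight act pointwise.
  have hbound : ∀ (e : Bool) (f : FreeGroup (Fin n) → ℝ) (E : ℝ), HasSum (fun h => f h ^ 2) E →
      (∀ k, Summable fun h => letterWeight c e k h * f h ^ 2) ∧
      ∑ k, ∑' h, letterWeight c e k h * f h ^ 2 ≤ 2 * c * E := by
    intro e f E hf
    have hle : ∀ h, ∑ k, letterWeight c e k h * f h ^ 2 ≤ 2 * c * f h ^ 2 := fun h => by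
      rw [← Finset.sum_mul]
      exact mul_le_mul_of_nonneg_right (sum_letterWeight_le hn e h) (sq_nonneg _)
    have hnn : ∀ k h, 0 ≤ letterWeight c e k h * f h ^ 2 := fun k h =>
      mul_nonneg (letterWeight_pos hc0 e k h).le (sq_nonneg _)
    have hs : ∀ k, Summable fun h => letterWeight c e k h * f h ^ 2 := fun k =>
      (hf.summable.mul_left (2 * c)).of_nonneg_of_le (hnn k) fun h =>
        (Finset.single_le_sum (fun j _ => hnn j h) (Finset.mem_univ k)).trans (hle h)
    refine ⟨hs, ?_⟩
    have h1 := hasSum_sum (s := Finset.univ) fun k _ => (hs k).hasSum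
    exact hasSum_le hle h1 (hf.mul_left _)
  obtain ⟨hs1, hle1⟩ := hbound false a A ha
  obtain ⟨hs2, hle2⟩ := hbound true b B hb
  -- Left translation by `g_k` is a bijection, so it does not change the weighted sum for `b`.
  have h2 : ∀ k, HasSum (fun h => letterWeight c true k (FreeGroup.of k * h) *
      b (FreeGroup.of k * h) ^ 2) (∑' h, letterWeight c true k h * b h ^ 2) := fun k =>
    (Equiv.mulLeft (FreeGroup.of k)).hasSum_iff.2 (hs2 k).hasSum
  have h3 : ∀ k, HasSum (fun h => (letterWeight c false k h * a h ^ 2 +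
      letterWeight c true k (FreeGroup.of k * h) * b (FreeGroup.of k * h) ^ 2) / 2)
      ((∑' h, letterWeight c false k h * a h ^ 2 + ∑' h, letterWeight c true k h * b h ^ 2) / 2) :=
    fun k => ((hs1 k).hasSum.add (h2 k)).div_const 2
  have hk : ∀ k h, a h * b (FreeGroup.of k * h) ≤ (letterWeight c false k h * a h ^ 2 +
      letterWeight c true k (FreeGroup.of k * h) * b (FreeGroup.of k * h) ^ 2) / 2 := fun k h => by
    rw [letterWeight_of_mul]
    exact mul_le_weighted_add_sq_div_two (letterWeight_pos hc0 false k h)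
  refine ⟨fun h => ∑ k, (letterWeight c false k h * a h ^ 2 +
      letterWeight c true k (FreeGroup.of k * h) * b (FreeGroup.of k * h) ^ 2) / 2,
    ∑ k, (∑' h, letterWeight c false k h * a h ^ 2 +
      ∑' h, letterWeight c true k h * b h ^ 2) / 2, ?_, ?_, ?_⟩
  · exact hasSum_sum fun k _ => h3 k
  · rw [← Finset.sum_div, Finset.sum_add_distrib]
    linarith
  · exact fun h => Finset.sum_le_sum fun k _ => hk k h

/-! ### Left and right translations on `ℓ²(G)` -/

section GroupOperators
variable {G : Type*} [Group G]

theorem leftRegular_apply (g : G) (ξ : lp (fun _ : G => ℂ) 2) (h : G) :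
    leftRegular g ξ h = ξ (g⁻¹ * h) := rfl

theorem leftRegular_one : leftRegular (1 : G) = 1 := by
  ext ξ h
  simp [leftRegular_apply]

theorem leftRegular_mul (g h : G) : leftRegular (g * h) = leftRegular g * leftRegular h := by
  ext ξ x
  simp [leftRegular_apply, mul_assoc]

theorem star_leftRegular (g : G) : star (leftRegular g) = leftRegular g⁻¹ := by
  symm
  rw [ContinuousLinearMap.star_eq_adjoint, ContinuousLinearMap.eq_adjoint_iff]
  intro ξ η
  refine (lp.hasSum_inner _ _).unique ?_
  rw [← (Equiv.mulLeft g).symm.hasSum_iff]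
  convert lp.hasSum_inner ξ (leftRegular g η) using 2 with h
  simp [leftRegular_apply]

theorem star_groupUnitary (g : G) : star (groupUnitary g) = groupUnitary g⁻¹ :=
  Subtype.ext (star_leftRegular g)

theorem groupUnitary_mul (g h : G) : groupUnitary (g * h) = groupUnitary g * groupUnitary h :=
  Subtype.ext (leftRegular_mul g h)

theorem groupUnitary_one : groupUnitary (1 : G) = 1 :=
  Subtype.ext leftRegular_one

/-- The right translations on `ℓ²(G)`, `(ρ(g) ξ)(h) = ξ(h g)`. -/
noncomputable def rightRegular (g : G) :
    lp (fun _ : G => ℂ) 2 →ₗᵢ[ℂ] lp (fun _ : G => ℂ) 2 where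
  toFun := fun ξ => ⟨fun h => ξ (h * g), by
    have h2 : (0 : ℝ) < (2 : ENNReal).toReal := by norm_num
    exact memℓp_gen (((lp.memℓp ξ).summable h2).comp_injective (mul_left_injective g))⟩
  map_add' := fun _ _ => rfl
  map_smul' := fun _ _ => rfl
  norm_map' := fun ξ => by
    have h2 : (0 : ℝ) < (2 : ENNReal).toReal := by norm_num
    rw [lp.norm_eq_tsum_rpow h2, lp.norm_eq_tsum_rpow h2]
    congr 1
    exact (Equiv.mulRight g).tsum_eq fun h => ‖ξ h‖ ^ (2 : ENNReal).toReal

theorem rightRegular_apply (g : G) (ξ : lp (fun _ : G => ℂ) 2) (h : G) :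
    rightRegular g ξ h = ξ (h * g) := rfl

theorem rightRegular_mul_leftRegular (g h : G) :
    (rightRegular g).toContinuousLinearMap * leftRegular h =
      leftRegular h * (rightRegular g).toContinuousLinearMap := by
  ext ξ x
  simp [leftRegular_apply, rightRegular_apply, mul_assoc]

/-- Right translations commute with all `λ(h)` and their adjoints `λ(h⁻¹)`, so they lie in the
commutant, while `x` lies in the double commutant. -/
theorem groupOperator_rightRegular (x : (groupVonNeumannAlgebra G).toStarSubalgebra) (g : G)
    (ξ : lp (fun _ : G => ℂ) 2) :
    groupOperator x (rightRegular g ξ) = rightRegular g (groupOperator x ξ) := by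
  have hx : groupOperator x ∈ Set.centralizer (Set.centralizer
      (Set.range (leftRegular (G := G)) ∪ star (Set.range leftRegular)) ∪
      star (Set.centralizer (Set.range (leftRegular (G := G)) ∪
        star (Set.range leftRegular)))) := x.2
  have hρ : (rightRegular g).toContinuousLinearMap ∈ Set.centralizer
      (Set.range (leftRegular (G := G)) ∪ star (Set.range leftRegular)) := by
    rintro y (⟨h, rfl⟩ | ⟨h, hy⟩)
    · exact (rightRegular_mul_leftRegular g h).symm
    · have hy' : y = leftRegular h⁻¹ := by rw [← star_leftRegular, hy, star_star]
      rw [hy']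
      exact (rightRegular_mul_leftRegular g _).symm
  exact (DFunLike.congr_fun (hx _ (Or.inl hρ)) ξ).symm

theorem leftRegular_groupVacuum (g : G) :
    leftRegular g (groupVacuum G) = rightRegular g⁻¹ (groupVacuum G) := by
  classical
  ext h
  rw [leftRegular_apply, rightRegular_apply, groupVacuum, lp.single_apply, lp.single_apply]
  by_cases hh : h = g
  · subst hh
    simp
  · rw [Pi.single_eq_of_ne, Pi.single_eq_of_ne]
    · exact fun h' => hh (mul_inv_eq_one.1 h')
    · exact fun h' => hh (inv_mul_eq_one.1 h').symm

theorem norm_groupVacuum : ‖groupVacuum G‖ = 1 := by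
  classical
  rw [groupVacuum]
  exact (lp.norm_single (by norm_num) _ _).trans norm_one

theorem groupTrace_one : groupTrace G 1 = 1 := by
  change inner ℂ (groupVacuum G) (groupVacuum G) = 1
  rw [inner_self_eq_norm_sq_to_K, norm_groupVacuum]
  simp

end GroupOperators

/-! ### Vector functionals and their Gram positivity -/

section VectorFunctional

theorem exists_eq_star_mul_self {A : Type*} [NonUnitalCStarAlgebra A] [PartialOrder A]
    [StarOrderedRing A] {a : A} (ha : 0 ≤ a) : ∃ b, a = star b * b :=
  CStarAlgebra.nonneg_iff_eq_star_mul_self.1 ha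

namespace VonNeumannAlgebra
variable {H : Type*} [NormedAddCommGroup H] [InnerProductSpace ℂ H] [CompleteSpace H]

/-- The normal functional `x ↦ ⟨ξ, x η⟩`. -/
noncomputable def vectorFunctional (R : VonNeumannAlgebra H) (ξ η : H) : R.Predual :=
  ⟨{ toFun := fun x => inner ℂ ξ ((x : H →L[ℂ] H) η)
     map_add' := fun x y => inner_add_right ξ ((x : H →L[ℂ] H) η) ((y : H →L[ℂ] H) η)
     map_smul' := fun c x => inner_smul_right ξ ((x : H →L[ℂ] H) η) c },
   R.isNormalFunctional_inner _ ξ η fun _ => rfl⟩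

theorem vectorFunctional_apply (R : VonNeumannAlgebra H) (ξ η : H) (x : R.toStarSubalgebra) :
    (R.vectorFunctional ξ η).1 x = inner ℂ ξ ((x : H →L[ℂ] H) η) := rfl

theorem star_apply_predual (R : VonNeumannAlgebra H) (φ : R.Predual) (x : R.toStarSubalgebra) :
    (star φ).1 x = star (φ.1 (star x)) := rfl

theorem star_vectorFunctional (R : VonNeumannAlgebra H) (ξ η : H) :
    star (R.vectorFunctional ξ η) = R.vectorFunctional η ξ := by
  refine Subtype.ext (LinearMap.ext fun x => ?_)
  rw [star_apply_predual, vectorFunctional_apply, vectorFunctional_apply, StarMemClass.coe_star,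
    ContinuousLinearMap.star_eq_adjoint, ContinuousLinearMap.adjoint_inner_right]
  exact inner_conj_symm _ _

/-- Factoring a positive `x` as `y* y` exhibits the amplified matrix as the Gram matrix of the
vectors `(y_{ra} ζ_i)_r`, indexed by pairs `(a, i)`. -/
theorem vectorFunctional_mem_pos (R : VonNeumannAlgebra H) {l : ℕ} (ζ : Fin l → H) :
    (Matrix.of fun i j => R.vectorFunctional (ζ i) (ζ j)) ∈ R.predualMatrixNormOrder.pos l := by
  intro m x hx
  obtain ⟨y, hy⟩ := exists_eq_star_mul_self hx
  have h : R.amplify (Matrix.of fun i j => R.vectorFunctional (ζ i) (ζ j)) x =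
      Matrix.gram ℂ fun P : Fin m × Fin l =>
        (WithLp.toLp 2 fun r => y r P.1 (ζ P.2) : PiLp 2 fun _ : Fin m => H) := by
    ext P Q
    have hxy : (x P.1 Q.1 : H →L[ℂ] H) = ∑ r, star (y r P.1) * y r Q.1 := by
      have := congrArg (fun M => M P.1 Q.1) hy
      simp only [CStarMatrix.mul_apply, CStarMatrix.star_apply] at this
      exact this
    rw [Matrix.gram_apply, PiLp.inner_apply]
    simp only [amplify, Matrix.of_apply, vectorFunctional_apply, hxy]
    simp [ContinuousLinearMap.star_eq_adjoint,
      ContinuousLinearMap.adjoint_inner_right]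
  rw [h]
  exact Matrix.posSemidef_gram ℂ _

theorem norm_vectorFunctional_le (R : VonNeumannAlgebra H) {ξ η : H} (hξ : ‖ξ‖ ≤ 1)
    (hη : ‖η‖ ≤ 1) :
    R.predualMatrixNormOrder.norm 1 (Matrix.of fun _ _ => R.vectorFunctional ξ η) ≤ 1 := by
  refine Real.sSup_le ?_ zero_le_one
  rintro _ ⟨m, x, hx, rfl⟩
  refine Matrix.l2_opNorm_le_of_forall _ zero_le_one fun a b => ?_
  rw [sum_amplify]
  simp only [Fin.sum_univ_one, Matrix.of_apply, vectorFunctional_apply]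
  refine (norm_sum_inner_le (R.toOperatorMatrix x) (WithLp.toLp 2 fun p => a (p, 0))
    (WithLp.toLp 2 fun q => b (q, 0)) ξ η).trans ?_
  calc _ ≤ 1 * (‖a‖ * ‖b‖) * (1 * 1) := by
        gcongr
        · exact norm_slice_le a 0
        · exact norm_slice_le b 0
    _ = _ := by ring

end VonNeumannAlgebra

variable {G : Type*} [Group G]

theorem tracePredual_groupUnitary_apply (g : G)
    (x : (groupVonNeumannAlgebra G).toStarSubalgebra) :
    (tracePredual (groupUnitary g)).1 x = groupTrace G (x * groupUnitary g) := rfl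

/-- The vector `λ(g)δ` equals a right translate of `δ`, and right translations are isometries that
commute with `L(G)`. -/
theorem vectorFunctional_leftRegular_self (g : G) :
    (groupVonNeumannAlgebra G).vectorFunctional (leftRegular g (groupVacuum G))
        (leftRegular g (groupVacuum G)) =
      (groupVonNeumannAlgebra G).vectorFunctional (groupVacuum G) (groupVacuum G) := by
  refine Subtype.ext (LinearMap.ext fun x => ?_)
  change inner ℂ _ (groupOperator x _) = inner ℂ _ (groupOperator x _)
  rw [leftRegular_groupVacuum, groupOperator_rightRegular, LinearIsometry.inner_map_map]

end VectorFunctional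

/-! ### The completely bounded norm of `e_k ↦ λ(g_k)*` -/

section FreeDual
variable {n : ℕ}

/-- The map `e_k ↦ λ(g_k)*` from `ℓ_∞^n` to `L(F_n)`. -/
noncomputable def freeGeneratorMap (n : ℕ) :
    (Fin n → ℂ) →ₗ[ℂ] (groupVonNeumannAlgebra (FreeGroup (Fin n))).toStarSubalgebra :=
  ∑ k, (LinearMap.proj k : (Fin n → ℂ) →ₗ[ℂ] ℂ).smulRight (groupUnitary (FreeGroup.of k)⁻¹)

theorem toOperatorMatrix_freeGeneratorMap {m : ℕ} (v : Matrix (Fin m) (Fin m) (Fin n → ℂ))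
    (p q : Fin m) :
    (groupVonNeumannAlgebra (FreeGroup (Fin n))).toOperatorMatrix (v.map (freeGeneratorMap n)) p q =
      ∑ k, v p q k • leftRegular (FreeGroup.of k)⁻¹ := by
  have h : (groupVonNeumannAlgebra (FreeGroup (Fin n))).toOperatorMatrix
      (v.map (freeGeneratorMap n)) p q =
      (groupVonNeumannAlgebra (FreeGroup (Fin n))).toStarSubalgebra.subtype
        (freeGeneratorMap n (v p q)) := rfl
  rw [h, freeGeneratorMap, LinearMap.sum_apply, map_sum]
  exact Finset.sum_congr rfl fun k _ => rfl

theorem hasSum_norm_sq_slice {G : Type*} {m : ℕ}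
    (ξ : PiLp 2 (fun _ : Fin m => lp (fun _ : G => ℂ) 2)) :
    HasSum (fun h => ‖(WithLp.toLp 2 fun p => ξ p h : EuclideanSpace ℂ (Fin m))‖ ^ 2)
      (‖ξ‖ ^ 2) := by
  rw [PiLp.norm_sq_eq_of_L2]
  simp only [PiLp.norm_sq_eq_of_L2]
  refine hasSum_sum fun p _ => ?_
  have h2 : (0 : ℝ) < (2 : ENNReal).toReal := by norm_num
  simpa using lp.hasSum_norm h2 (ξ p)

theorem norm_toOperatorMatrix_freeGeneratorMap_le (hn : 2 ≤ n) {m : ℕ}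
    (v : Matrix (Fin m) (Fin m) (Fin n → ℂ)) :
    ‖(groupVonNeumannAlgebra (FreeGroup (Fin n))).toOperatorMatrix
        (v.map (freeGeneratorMap n))‖ ≤
      2 * √((n : ℝ) - 1) * ‖CStarMatrix.ofMatrix v‖ := by
  rw [← norm_operatorMatrixHom]
  refine ContinuousLinearMap.opNorm_le_of_re_inner_le (𝕜 := ℂ) (by positivity)
    fun ξ η hξ hη => ?_
  rw [inner_re_symm]
  refine (Complex.re_le_norm _).trans ?_
  -- As `(λ(g_k)* ξ)(h) = ξ(g_k h)`, the coefficient is `∑ₕ ∑ₖ ⟨η(h), v_k ξ(g_k h)⟩` over slices in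
  -- `ℂ^m`, where `v_k` is the `k`-th coordinate of `v`.
  have hsum : HasSum (fun h => ∑ k, ∑ p, ∑ q, star (η p h) * ξ q (FreeGroup.of k * h) * v p q k)
      (inner ℂ η (operatorMatrixHom (lp (fun _ : FreeGroup (Fin n) => ℂ) 2) m ((groupVonNeumannAlgebra
        (FreeGroup (Fin n))).toOperatorMatrix (v.map (freeGeneratorMap n))) ξ)) := by
    rw [inner_operatorMatrixHom]
    have h1 : ∀ p q, HasSum (fun h => ∑ k, star (η p h) * ξ q (FreeGroup.of k * h) * v p q k)
        (inner ℂ (η p) ((groupVonNeumannAlgebra (FreeGroup (Fin n))).toOperatorMatrix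
          (v.map (freeGeneratorMap n)) p q (ξ q))) := by
      intro p q
      rw [toOperatorMatrix_freeGeneratorMap, sum_apply, inner_sum]
      refine hasSum_sum fun k _ => ?_
      have := (lp.hasSum_inner (η p) (leftRegular (FreeGroup.of k)⁻¹ (ξ q))).mul_right (v p q k)
      rw [smul_apply, inner_smul_right, mul_comm]
      refine (congrArg (fun f => HasSum f _) (funext fun h => ?_)).mpr this
      rw [leftRegular_apply, inv_inv, RCLike.inner_apply, starRingEnd_apply, mul_comm (star _)]
    have h2 := hasSum_sum (s := Finset.univ) fun p _ =>
      hasSum_sum (s := Finset.univ) fun q _ => h1 p q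
    convert h2 using 2 with h
    rw [Finset.sum_comm]
    exact Finset.sum_congr rfl fun p _ => Finset.sum_comm
  -- The tree estimate is applied to the slice norms; for unit vectors it gives `√(n-1) (1 + 1)`.
  obtain ⟨F, S, hF, hS, hle⟩ := exists_hasSum_free_generators hn _ _
    (hasSum_norm_sq_slice η) (hasSum_norm_sq_slice ξ)
  rw [hξ, hη] at hS
  rw [← hsum.tsum_eq]
  refine (tsum_of_norm_bounded (hF.mul_left ‖CStarMatrix.ofMatrix v‖) fun h => ?_).trans ?_
  · refine le_trans ?_ (mul_le_mul_of_nonneg_left (hle h) (norm_nonneg _))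
    rw [Finset.mul_sum]
    refine norm_sum_le_of_le _ fun k _ => ?_
    refine (Matrix.norm_sum_sum_le_l2_opNorm (matrixEval m k (CStarMatrix.ofMatrix v))
      (WithLp.toLp 2 fun p => η p h) (WithLp.toLp 2 fun q => ξ q (FreeGroup.of k * h))).trans ?_
    exact mul_le_mul_of_nonneg_right (norm_matrixEval_le k _) (by positivity)
  · rw [mul_comm]
    refine mul_le_mul_of_nonneg_right (hS.trans (le_of_eq (by ring))) (norm_nonneg _)

end FreeDual

/-! ### Positivity and size of elements of the Delta cone -/

namespace VonNeumannAlgebra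
variable {H : Type*} [NormedAddCommGroup H] [InnerProductSpace ℂ H] [CompleteSpace H]

theorem evalSmul_apply (R : VonNeumannAlgebra H) {n : ℕ} (i : Fin n) (y : R.toStarSubalgebra)
    (f : Fin n → ℂ) : R.evalSmul i y f = f i • y := rfl

theorem evalSmul_single (R : VonNeumannAlgebra H) {n : ℕ} (i k : Fin n)
    (y : R.toStarSubalgebra) : R.evalSmul i y (Pi.single k 1) = if k = i then y else 0 := by
  rw [evalSmul_apply, Pi.single_apply, ite_smul, one_smul, zero_smul]
  simp only [eq_comm]

theorem sum_apply_evalSmul_single (R : VonNeumannAlgebra H) {n : ℕ} (i : Fin n)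
    (y : R.toStarSubalgebra) (φ : Fin n → R.Predual) :
    ∑ k, (φ k).1 (R.evalSmul i y (Pi.single k 1)) = (φ i).1 y := by
  rw [Finset.sum_eq_single i]
  · rw [evalSmul_single, if_pos rfl]
  · intro k _ hk
    rw [evalSmul_single, if_neg hk, map_zero]
  · simp

/-- Complete positivity of the pairing of the cone of `ℓ_∞^n ⊗_Δ R_*` with positive matrices over
`R`, at a coordinate of `ℓ_∞^n`. -/
theorem sum_dualPairing_nonneg (R : VonNeumannAlgebra H) {n : ℕ} {ι : Type*}
    {z : Matrix ι ι ((Fin n → ℂ) ⊗[ℂ] R.Predual)}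
    (hz : z ∈ deltaCone (CStarAlgebra.matrixNormOrder (Fin n → ℂ)) R.predualMatrixNormOrder ι)
    (t : Fin n) {m : ℕ} (e : Fin m → ι) {x : Matrix (Fin m) (Fin m) R.toStarSubalgebra}
    (hx : 0 ≤ R.toOperatorMatrix x) :
    0 ≤ ∑ a, ∑ b, R.dualPairing (R.evalSmul t (x a b)) (z (e a) (e b)) := by
  obtain ⟨k, l, α, v, hv, w, hw, rfl⟩ := hz
  obtain ⟨y, hy⟩ := exists_eq_star_mul_self (show 0 ≤ CStarMatrix.ofMatrix v from hv)
  have hvt : ∀ p q, v p q t = ∑ r, star (y r p t) * y r q t := by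
    intro p q
    have := congrFun (congrArg (fun M => M p q) hy) t
    simp only [CStarMatrix.mul_apply, CStarMatrix.star_apply, Finset.sum_apply, Pi.mul_apply,
      Pi.star_apply] at this
    exact this
  have hpos := hw m x hx
  -- With `v = y* y`, the rows of `y` at coordinate `t` and the matrix `α` are absorbed into vectors
  -- `ζ r`, leaving a sum of quadratic forms of the positive matrix `R.amplify w x`.
  let ζ : Fin k → Fin m × Fin l → ℂ := fun r A => ∑ p, y r p t * star (α (e A.1) (p, A.2))
  have key : ∑ a, ∑ b, R.dualPairing (R.evalSmul t (x a b))
      (scalarSandwich α (matrixTmul v w) α.conjTranspose (e a) (e b)) =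
      ∑ r, star (ζ r) ⬝ᵥ (R.amplify w x).mulVec (ζ r) := by
    have h1 : ∀ a b, R.dualPairing (R.evalSmul t (x a b))
        (scalarSandwich α (matrixTmul v w) α.conjTranspose (e a) (e b)) =
        ∑ r, ∑ i, ∑ j, star (ζ r (a, i)) * ((w i j).1 (x a b) * ζ r (b, j)) := by
      intro a b
      have h2 : ∀ r i j, star (ζ r (a, i)) * ((w i j).1 (x a b) * ζ r (b, j)) =
          ∑ p, ∑ q, star (y r p t) * y r q t * (α (e a) (p, i) * star (α (e b) (q, j)) *
            (w i j).1 (x a b)) := by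
        intro r i j
        simp only [ζ, star_sum, star_mul', star_star, Finset.sum_mul, Finset.mul_sum]
        rw [Finset.sum_comm]
        exact Finset.sum_congr rfl fun p _ => Finset.sum_congr rfl fun q _ => by ring
      simp only [h2]
      simp only [scalarSandwich, matrixTmul, Matrix.of_apply, map_sum, map_smul,
        Matrix.kroneckerMap, dualPairing_tmul, evalSmul_apply, hvt, Matrix.conjTranspose_apply,
        Fintype.sum_prod_type, smul_eq_mul]
      calc _ = ∑ p, ∑ i, ∑ q, ∑ j, ∑ r, star (y r p t) * y r q t *
            (α (e a) (p, i) * star (α (e b) (q, j)) * (w i j).1 (x a b)) := by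
            refine Finset.sum_congr rfl fun p _ => Finset.sum_congr rfl fun i _ =>
              Finset.sum_congr rfl fun q _ => Finset.sum_congr rfl fun j _ => ?_
            rw [← Finset.sum_mul]
            ring
        _ = ∑ i, ∑ j, ∑ r, ∑ p, ∑ q, star (y r p t) * y r q t *
            (α (e a) (p, i) * star (α (e b) (q, j)) * (w i j).1 (x a b)) := by
            rw [Finset.sum_comm]
            refine Finset.sum_congr rfl fun i _ => ?_
            calc _ = ∑ p, ∑ j, ∑ r, ∑ q, star (y r p t) * y r q t *
                  (α (e a) (p, i) * star (α (e b) (q, j)) * (w i j).1 (x a b)) := by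
                  refine Finset.sum_congr rfl fun p _ => ?_
                  rw [Finset.sum_comm]
                  exact Finset.sum_congr rfl fun j _ => Finset.sum_comm
              _ = _ := by
                  rw [Finset.sum_comm]
                  exact Finset.sum_congr rfl fun j _ => Finset.sum_comm
        _ = _ := by
            rw [Finset.sum_comm_cycle]
    simp only [h1]
    simp only [dotProduct, Matrix.mulVec, Fintype.sum_prod_type, amplify, Matrix.of_apply,
      Pi.star_apply, Finset.mul_sum]
    calc _ = ∑ a, ∑ r, ∑ b, ∑ i, ∑ j, star (ζ r (a, i)) * ((w i j).1 (x a b) * ζ r (b, j)) :=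
          Finset.sum_congr rfl fun a _ => Finset.sum_comm
      _ = ∑ r, ∑ a, ∑ b, ∑ i, ∑ j, star (ζ r (a, i)) * ((w i j).1 (x a b) * ζ r (b, j)) :=
          Finset.sum_comm
      _ = _ := Finset.sum_congr rfl fun r _ => Finset.sum_congr rfl fun a _ => Finset.sum_comm
  rw [key]
  exact Finset.sum_nonneg fun r _ => hpos.dotProduct_mulVec_nonneg _

theorem norm_dualPairing_le_deltaAbs (R : VonNeumannAlgebra H) {n : ℕ} (t : Fin n) {ι : Type*}
    [Fintype ι] [DecidableEq ι] {u : Matrix ι ι ((Fin n → ℂ) ⊗[ℂ] R.Predual)}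
    (hu : u ∈ deltaCone (CStarAlgebra.matrixNormOrder (Fin n → ℂ)) R.predualMatrixNormOrder ι)
    (i j : ι) :
    ‖R.dualPairing (R.evalSmul t 1) (u i j)‖ ≤
      deltaAbs (CStarAlgebra.matrixNormOrder (Fin n → ℂ)) R.predualMatrixNormOrder u := by
  obtain ⟨k, l, α, v, hv, w, hw, h⟩ := hu
  refine le_csInf ⟨_, k, l, α, v, hv, w, hw, h, rfl⟩ ?_
  rintro _ ⟨k, l, α, v, hv, w, hw, rfl, rfl⟩
  refine (R.norm_dualPairing_scalarSandwich_le (R.evalSmul t 1) rfl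
    (R.norm_toOperatorMatrix_evalSmul_one_le t v) i j).trans (le_of_eq ?_)
  rw [Matrix.l2_opNorm_conjTranspose]
  change _ = ‖α‖ ^ 2 * ‖CStarMatrix.ofMatrix v‖ * _
  ring

/-- The factor has `c` as its row `0` and zeros below, which keeps the factorisation among square
matrices. -/
theorem toOperatorMatrix_star_mul_nonneg (R : VonNeumannAlgebra H) {m : ℕ} [NeZero m]
    (c : Fin m → R.toStarSubalgebra) :
    0 ≤ R.toOperatorMatrix (Matrix.of fun a b => star (c a) * c b) := by
  have h : R.toOperatorMatrix (Matrix.of fun a b => star (c a) * c b) =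
      star (CStarMatrix.ofMatrix fun a b => if a = 0 then (c b : H →L[ℂ] H) else 0) *
        (CStarMatrix.ofMatrix fun a b => if a = 0 then (c b : H →L[ℂ] H) else 0) := by
    ext1 a b
    rw [CStarMatrix.mul_apply]
    change star (c a : H →L[ℂ] H) * (c b : H →L[ℂ] H) =
      ∑ r, star (if r = 0 then (c a : H →L[ℂ] H) else 0) * (if r = 0 then (c b : H →L[ℂ] H) else 0)
    rw [Finset.sum_eq_single 0]
    · simp
    · intro r _ hr
      simp [hr]
    · simp
  rw [h]
  exact star_mul_self_nonneg _

end VonNeumannAlgebra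

/-! ### Explicit representations of `∑ e_k ⊗ φ_k` -/

section Representations
variable {n : ℕ} {W : Type*} [AddCommGroup W] [Module ℂ W]

/-- The diagonal matrix with entries `e_1, …, e_n` over `ℓ_∞^n`. -/
noncomputable def basisDiagonal (n : ℕ) : Matrix (Fin n) (Fin n) (Fin n → ℂ) :=
  Matrix.diagonal fun k => Pi.single k 1

theorem basisDiagonal_nonneg (n : ℕ) : 0 ≤ CStarMatrix.ofMatrix (basisDiagonal n) := by
  have h : CStarMatrix.ofMatrix (basisDiagonal n) =
      star (CStarMatrix.ofMatrix (basisDiagonal n)) * CStarMatrix.ofMatrix (basisDiagonal n) := by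
    change basisDiagonal n = (basisDiagonal n).conjTranspose * basisDiagonal n
    rw [basisDiagonal, Matrix.diagonal_conjTranspose, Matrix.diagonal_mul_diagonal]
    congr 1
    ext k j
    by_cases hj : j = k
    · subst hj
      simp
    · simp [Pi.single_eq_of_ne hj]
  rw [h]
  exact star_mul_self_nonneg _

/-- The `0`-`1` matrix whose row `a` has its ones at the places `(p, σ a p)`. -/
noncomputable def selectionMatrix {ι : Type*} {l : ℕ} (σ : ι → Fin n → Fin l) :
    Matrix ι (Fin n × Fin l) ℂ :=
  Matrix.of fun a P => if P.2 = σ a P.1 then 1 else 0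

/-- The diagonal factor forces the two `ℓ_∞^n` indices to agree, and the selection matrices then
pick a single entry of `w` for each `k`. -/
theorem scalarSandwich_selectionMatrix {ι : Type*} {l : ℕ} (σ τ : ι → Fin n → Fin l)
    (w : Matrix (Fin l) (Fin l) W) (a b : ι) :
    scalarSandwich (selectionMatrix σ) (matrixTmul (basisDiagonal n) w)
        (selectionMatrix τ).conjTranspose a b =
      ∑ k, (Pi.single k 1 : Fin n → ℂ) ⊗ₜ[ℂ] w (σ a k) (τ b k) := by
  simp only [scalarSandwich, selectionMatrix, matrixTmul, basisDiagonal, Matrix.of_apply,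
    Matrix.conjTranspose_apply, Matrix.kroneckerMap, Fintype.sum_prod_type]
  refine Finset.sum_congr rfl fun p _ => ?_
  rw [Finset.sum_eq_single (σ a p)]
  · rw [Finset.sum_eq_single p]
    · rw [Finset.sum_eq_single (τ b p)]
      · simp
      · intro j _ hj
        simp [hj]
      · simp
    · intro q _ hq
      refine Finset.sum_eq_zero fun j _ => ?_
      rw [Matrix.diagonal_apply_ne' _ hq, TensorProduct.zero_tmul, smul_zero]
    · simp
  · intro i _ hi
    simp [hi]
  · simp

end Representations

section BasisTensor

variable {n : ℕ} {W : Type*} [AddCommGroup W] [Module ℂ W]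

/-- The element `∑ e_k ⊗ φ_k`, as a `1 × 1` matrix. -/
noncomputable def basisTensor (φ : Fin n → W) : Matrix (Fin 1) (Fin 1) ((Fin n → ℂ) ⊗[ℂ] W) :=
  Matrix.of fun _ _ => ∑ k, (Pi.single k 1 : Fin n → ℂ) ⊗ₜ[ℂ] φ k

theorem basisTensor_apply (φ : Fin n → W) (i j : Fin 1) :
    basisTensor φ i j = ∑ k, (Pi.single k 1 : Fin n → ℂ) ⊗ₜ[ℂ] φ k := rfl

theorem star_single_tmul [StarAddMonoid W] [StarModule ℂ W] (k : Fin n) (φ : W) :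
    star ((Pi.single k 1 : Fin n → ℂ) ⊗ₜ[ℂ] φ) = (Pi.single k 1 : Fin n → ℂ) ⊗ₜ[ℂ] star φ := by
  rw [TensorProduct.star_tmul, Pi.star_single, star_one]

theorem conjTranspose_basisTensor [StarAddMonoid W] [StarModule ℂ W] (φ : Fin n → W) :
    (basisTensor φ).conjTranspose = basisTensor fun k => star (φ k) := by
  ext1 i j
  rw [Matrix.conjTranspose_apply, basisTensor_apply, basisTensor_apply, star_sum]
  exact Finset.sum_congr rfl fun k _ => star_single_tmul k (φ k)

theorem basisTensor_const (φ : W) (i j : Fin 1) :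
    basisTensor (fun _ : Fin n => φ) i j = (1 : Fin n → ℂ) ⊗ₜ[ℂ] φ := by
  rw [basisTensor_apply, ← TensorProduct.sum_tmul]
  congr 1
  exact Finset.univ_sum_single 1

theorem basisTensor_const_eq (φ : W) :
    basisTensor (fun _ : Fin n => φ) =
      scalarSandwich (Matrix.of fun (_ : Fin 1) (_ : Fin 1 × Fin 1) => (1 : ℂ))
        (matrixTmul (Matrix.of fun _ _ => (1 : Fin n → ℂ)) (Matrix.of fun _ _ => φ))
        (Matrix.of fun (_ : Fin 1) (_ : Fin 1 × Fin 1) => (1 : ℂ)).conjTranspose := by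
  ext1 i j
  rw [basisTensor_const]
  simp [scalarSandwich, matrixTmul]

theorem basisTensor_eq (φ : Fin n → W) {l : ℕ} (w : Matrix (Fin l) (Fin l) W)
    (σ τ : Fin n → Fin l) (h : ∀ k, w (σ k) (τ k) = φ k) :
    basisTensor φ = scalarSandwich (selectionMatrix fun (_ : Fin 1) => σ)
        (matrixTmul (basisDiagonal n) w)
        (selectionMatrix fun (_ : Fin 1) => τ).conjTranspose := by
  ext1 i j
  rw [scalarSandwich_selectionMatrix, basisTensor_apply]
  simp only [h]

theorem fromBlocks_basisTensor_eq (φ₁₁ φ₁₂ φ₂₁ φ₂₂ : Fin n → W) {l : ℕ}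
    (w : Matrix (Fin l) (Fin l) W) (σ τ : Fin n → Fin l)
    (h₁₁ : ∀ k, w (σ k) (σ k) = φ₁₁ k) (h₁₂ : ∀ k, w (σ k) (τ k) = φ₁₂ k)
    (h₂₁ : ∀ k, w (τ k) (σ k) = φ₂₁ k) (h₂₂ : ∀ k, w (τ k) (τ k) = φ₂₂ k) :
    Matrix.fromBlocks (basisTensor φ₁₁) (basisTensor φ₁₂) (basisTensor φ₂₁) (basisTensor φ₂₂) =
      scalarSandwich (selectionMatrix (Sum.elim (fun _ => σ) fun _ => τ))
        (matrixTmul (basisDiagonal n) w)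
        (selectionMatrix (Sum.elim (fun _ => σ) fun _ => τ)).conjTranspose := by
  ext1 a b
  rw [scalarSandwich_selectionMatrix]
  rcases a with a | a <;> rcases b with b | b <;>
  simp only [Matrix.fromBlocks_apply₁₁, Matrix.fromBlocks_apply₁₂, Matrix.fromBlocks_apply₂₁,
    Matrix.fromBlocks_apply₂₂, basisTensor_apply, Sum.elim_inl, Sum.elim_inr, h₁₁, h₁₂, h₂₁, h₂₂]

end BasisTensor

theorem ofMatrix_const_one (n : ℕ) :
    CStarMatrix.ofMatrix (Matrix.of fun (_ _ : Fin 1) => (1 : Fin n → ℂ)) = 1 := by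
  ext1 i j
  rw [Subsingleton.elim i j, CStarMatrix.one_apply_eq]
  rfl

theorem const_one_mem_pos (n : ℕ) : (Matrix.of fun (_ _ : Fin 1) => (1 : Fin n → ℂ)) ∈
    (CStarAlgebra.matrixNormOrder (Fin n → ℂ)).pos 1 := by
  change 0 ≤ CStarMatrix.ofMatrix (Matrix.of fun (_ _ : Fin 1) => (1 : Fin n → ℂ))
  rw [ofMatrix_const_one]
  have h := star_mul_self_nonneg (1 : CStarMatrix (Fin 1) (Fin 1) (Fin n → ℂ))
  rwa [star_one, one_mul] at h

/-- The C⋆-identity gives `‖1‖² = ‖1‖`; this also covers `n = 0`, where `1 = 0`. -/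
theorem norm_const_one_le (n : ℕ) : (CStarAlgebra.matrixNormOrder (Fin n → ℂ)).norm 1
    (Matrix.of fun _ _ => (1 : Fin n → ℂ)) ≤ 1 := by
  change ‖CStarMatrix.ofMatrix (Matrix.of fun (_ _ : Fin 1) => (1 : Fin n → ℂ))‖ ≤ 1
  rw [ofMatrix_const_one]
  have h := CStarRing.norm_star_mul_self (x := (1 : CStarMatrix (Fin 1) (Fin 1) (Fin n → ℂ)))
  rw [star_one, one_mul] at h
  nlinarith [norm_nonneg (1 : CStarMatrix (Fin 1) (Fin 1) (Fin n → ℂ))]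

theorem norm_row_one_le :
    ‖Matrix.of fun (_ : Fin 1) (_ : Fin 1 × Fin 1) => (1 : ℂ)‖ ≤ 1 := by
  refine Matrix.l2_opNorm_le_of_forall _ zero_le_one fun a b => ?_
  simp only [Fintype.sum_prod_type, Fin.sum_univ_one, Matrix.of_apply, mul_one, norm_mul,
    norm_star, one_mul]
  exact mul_le_mul (PiLp.norm_apply_le a _) (PiLp.norm_apply_le b _) (norm_nonneg _)
    (norm_nonneg _)

/-! ### Evaluating the Delta norm, and duality for the projective norm -/

namespace VonNeumannAlgebra
variable {H : Type*} [NormedAddCommGroup H] [InnerProductSpace ℂ H] [CompleteSpace H]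
  (R : VonNeumannAlgebra H) {n : ℕ}

theorem basisTensor_const_mem (ζ : H) :
    basisTensor (fun _ : Fin n => R.vectorFunctional ζ ζ) ∈
      deltaCone (CStarAlgebra.matrixNormOrder (Fin n → ℂ)) R.predualMatrixNormOrder (Fin 1) :=
  ⟨1, 1, _, _, const_one_mem_pos n, _, R.vectorFunctional_mem_pos fun _ => ζ,
    basisTensor_const_eq _⟩

theorem deltaAbs_basisTensor_const_le {ζ : H} (hζ : ‖ζ‖ ≤ 1) :
    deltaAbs (CStarAlgebra.matrixNormOrder (Fin n → ℂ)) R.predualMatrixNormOrder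
      (basisTensor fun _ : Fin n => R.vectorFunctional ζ ζ) ≤ 1 := by
  have hnn : ∀ (k : ℕ) (v : Matrix (Fin k) (Fin k) (Fin n → ℂ)),
      0 ≤ (CStarAlgebra.matrixNormOrder (Fin n → ℂ)).norm k v := fun k v =>
    norm_nonneg (CStarMatrix.ofMatrix v)
  have hc : 0 ∈ lowerBounds {c : ℝ | ∃ (k l : ℕ) (α : Matrix (Fin 1) (Fin k × Fin l) ℂ),
      ∃ v ∈ (CStarAlgebra.matrixNormOrder (Fin n → ℂ)).pos k,
      ∃ w ∈ R.predualMatrixNormOrder.pos l,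
      (basisTensor fun _ : Fin n => R.vectorFunctional ζ ζ) =
        scalarSandwich α (matrixTmul v w) α.conjTranspose ∧
      c = ‖α‖ ^ 2 * (CStarAlgebra.matrixNormOrder (Fin n → ℂ)).norm k v *
        R.predualMatrixNormOrder.norm l w} := by
    rintro _ ⟨k, l, α, v, -, w, -, -, rfl⟩
    exact mul_nonneg (mul_nonneg (sq_nonneg _) (hnn k v)) (R.predual_norm_nonneg w)
  have hle := csInf_le ⟨0, hc⟩ ⟨1, 1, _, _, const_one_mem_pos n, _,
    R.vectorFunctional_mem_pos fun _ => ζ, basisTensor_const_eq _, rfl⟩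
  refine hle.trans ?_
  calc _ ≤ (1 : ℝ) ^ 2 * 1 * 1 :=
        mul_le_mul (mul_le_mul (pow_le_pow_left₀ (norm_nonneg _) norm_row_one_le 2)
          (norm_const_one_le n) (hnn _ _) (by positivity)) (R.norm_vectorFunctional_le hζ hζ)
          (R.predual_norm_nonneg _) (by positivity)
    _ = 1 := by norm_num

/-- The block is cut out of `diag(e_k) ⊗ w`, with `w` the Gram matrix of `(ζ₀, ζ)`: the first row of
the selection uses index `0` for all `k`, the second index `k + 1`. Only membership matters: the
norm `√n` of the selection matrix does not enter, since the Delta norm measures just the diagonal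
blocks. -/
theorem fromBlocks_basisTensor_mem (ζ₀ : H) (ζ : Fin n → H)
    (h : ∀ k, R.vectorFunctional (ζ k) (ζ k) = R.vectorFunctional ζ₀ ζ₀) :
    Matrix.fromBlocks (basisTensor fun _ : Fin n => R.vectorFunctional ζ₀ ζ₀)
        (basisTensor fun k => R.vectorFunctional ζ₀ (ζ k))
        (basisTensor fun k => R.vectorFunctional ζ₀ (ζ k)).conjTranspose
        (basisTensor fun _ : Fin n => R.vectorFunctional ζ₀ ζ₀) ∈
      deltaCone (CStarAlgebra.matrixNormOrder (Fin n → ℂ)) R.predualMatrixNormOrder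
        (Fin 1 ⊕ Fin 1) := by
  refine ⟨n, n + 1, selectionMatrix (Sum.elim (fun _ _ => 0) fun _ k => k.succ), basisDiagonal n,
    basisDiagonal_nonneg n, _,
    R.vectorFunctional_mem_pos (Fin.cons (α := fun _ => H) ζ₀ ζ), ?_⟩
  rw [conjTranspose_basisTensor]
  refine fromBlocks_basisTensor_eq _ _ _ _ _ _ _ ?_ ?_ ?_ ?_
  · exact fun k => rfl
  · exact fun k => rfl
  · exact fun k => (R.star_vectorFunctional _ _).symm
  · exact fun k => h k

theorem dualPairing_basisTensor {R : VonNeumannAlgebra H} (T : (Fin n → ℂ) →ₗ[ℂ] R.toStarSubalgebra)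
    (φ : Fin n → R.Predual) (i j : Fin 1) :
    R.dualPairing T (basisTensor φ i j) = ∑ k, (φ k).1 (T (Pi.single k 1)) := by
  simp only [basisTensor_apply, map_sum, dualPairing_tmul]

theorem one_le_max_of_nonneg {a b c d : ℂ} {A B : ℝ} (h : 0 ≤ a + c + (d + b)) (hc : c = -1)
    (hd : d = -1) (ha : ‖a‖ ≤ A) (hb : ‖b‖ ≤ B) : 1 ≤ max A B := by
  subst hc hd
  have hre := (Complex.le_def.1 h).1
  simp only [Complex.add_re, Complex.neg_re, Complex.one_re, Complex.zero_re] at hre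
  have h3 := (Complex.re_le_norm _).trans ha
  have h4 := (Complex.re_le_norm _).trans hb
  rw [le_max_iff]
  by_contra! hcon
  linarith [hcon.1, hcon.2]

/-- Pairing the block at coordinate `t` with the positive matrix `[1, -y; -y*, y* y]`, where `y* y =
1`, gives `u(1) + u'(1) - 2 ≥ 0`. Each of `u(1)`, `u'(1)` is bounded by the corresponding
`deltaAbs`. -/
theorem one_le_max_deltaAbs (t : Fin n) (φ : Fin n → R.Predual) {y : R.toStarSubalgebra}
    (hy : star y * y = 1) (hφ : (φ t).1 y = 1)
    {u u' : Matrix (Fin 1) (Fin 1) ((Fin n → ℂ) ⊗[ℂ] R.Predual)}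
    (hu : u ∈ deltaCone (CStarAlgebra.matrixNormOrder (Fin n → ℂ))
      R.predualMatrixNormOrder (Fin 1))
    (hu' : u' ∈ deltaCone (CStarAlgebra.matrixNormOrder (Fin n → ℂ))
      R.predualMatrixNormOrder (Fin 1))
    (hz : Matrix.fromBlocks u (basisTensor φ) (basisTensor φ).conjTranspose u' ∈
      deltaCone (CStarAlgebra.matrixNormOrder (Fin n → ℂ)) R.predualMatrixNormOrder
        (Fin 1 ⊕ Fin 1)) :
    1 ≤ max (deltaAbs (CStarAlgebra.matrixNormOrder (Fin n → ℂ)) R.predualMatrixNormOrder u)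
      (deltaAbs (CStarAlgebra.matrixNormOrder (Fin n → ℂ)) R.predualMatrixNormOrder u') := by
  have hbound : ∀ {u : Matrix (Fin 1) (Fin 1) ((Fin n → ℂ) ⊗[ℂ] R.Predual)},
      u ∈ deltaCone (CStarAlgebra.matrixNormOrder (Fin n → ℂ)) R.predualMatrixNormOrder (Fin 1) →
      ∀ {x : R.toStarSubalgebra}, x = 1 → ‖R.dualPairing (R.evalSmul t x) (u 0 0)‖ ≤
        deltaAbs (CStarAlgebra.matrixNormOrder (Fin n → ℂ)) R.predualMatrixNormOrder u := by
    rintro u hu _ rfl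
    exact R.norm_dualPairing_le_deltaAbs t hu 0 0
  rw [conjTranspose_basisTensor] at hz
  have h := R.sum_dualPairing_nonneg hz t ![Sum.inl 0, Sum.inr 0]
    (R.toOperatorMatrix_star_mul_nonneg ![1, -y])
  rw [Fin.sum_univ_two, Fin.sum_univ_two, Fin.sum_univ_two] at h
  have e₁₁ : star (1 : R.toStarSubalgebra) * 1 = 1 := by rw [star_one, one_mul]
  have e₂₂ : star (-y) * (-y) = 1 := by rw [star_neg, neg_mul_neg, hy]
  have e₁₂ : R.dualPairing (R.evalSmul t (star 1 * -y)) (basisTensor φ 0 0) = -1 := by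
    rw [dualPairing_basisTensor, R.sum_apply_evalSmul_single, star_one, one_mul, map_neg, hφ]
  have e₂₁ : R.dualPairing (R.evalSmul t (star (-y) * 1))
      (basisTensor (fun k => star (φ k)) 0 0) = -1 := by
    rw [dualPairing_basisTensor, R.sum_apply_evalSmul_single, mul_one, star_apply_predual,
      star_star, map_neg, hφ, star_neg, star_one]
  exact one_le_max_of_nonneg h e₁₂ e₂₁ (hbound hu e₁₁) (hbound hu' e₂₂)

theorem deltaNorm_basisTensor_eq_one {ζ₀ : H} (hζ₀ : ‖ζ₀‖ ≤ 1) (ζ : Fin n → H)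
    (h : ∀ k, R.vectorFunctional (ζ k) (ζ k) = R.vectorFunctional ζ₀ ζ₀)
    (t : Fin n) {y : R.toStarSubalgebra} (hy : star y * y = 1)
    (hφ : (R.vectorFunctional ζ₀ (ζ t)).1 y = 1) :
    deltaNorm (CStarAlgebra.matrixNormOrder (Fin n → ℂ)) R.predualMatrixNormOrder
      (basisTensor fun k => R.vectorFunctional ζ₀ (ζ k)) = 1 := by
  have hmem := R.basisTensor_const_mem (n := n) ζ₀
  have hblock := R.fromBlocks_basisTensor_mem ζ₀ ζ h
  refine le_antisymm ?_ ?_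
  · have hlb : 1 ∈ lowerBounds {c : ℝ |
        ∃ u ∈ deltaCone (CStarAlgebra.matrixNormOrder (Fin n → ℂ)) R.predualMatrixNormOrder (Fin 1),
        ∃ u' ∈ deltaCone (CStarAlgebra.matrixNormOrder (Fin n → ℂ)) R.predualMatrixNormOrder
          (Fin 1),
        Matrix.fromBlocks u (basisTensor fun k => R.vectorFunctional ζ₀ (ζ k))
          (basisTensor fun k => R.vectorFunctional ζ₀ (ζ k)).conjTranspose u' ∈
          deltaCone (CStarAlgebra.matrixNormOrder (Fin n → ℂ)) R.predualMatrixNormOrder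
            (Fin 1 ⊕ Fin 1) ∧
        c = max (deltaAbs (CStarAlgebra.matrixNormOrder (Fin n → ℂ)) R.predualMatrixNormOrder u)
          (deltaAbs (CStarAlgebra.matrixNormOrder (Fin n → ℂ)) R.predualMatrixNormOrder u')} := by
      rintro _ ⟨u, hu, u', hu', hz, rfl⟩
      exact R.one_le_max_deltaAbs t _ hy hφ hu hu' hz
    have hle := csInf_le ⟨1, hlb⟩ ⟨_, hmem, _, hmem, hblock, rfl⟩
    exact hle.trans (max_le (R.deltaAbs_basisTensor_const_le hζ₀)
      (R.deltaAbs_basisTensor_const_le hζ₀))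
  · refine le_csInf ⟨_, _, hmem, _, hmem, hblock, rfl⟩ ?_
    rintro _ ⟨u, hu, u', hu', hz, rfl⟩
    exact R.one_le_max_deltaAbs t _ hy hφ hu hu' hz

/-- Duality between the projective norm and completely bounded maps `ℓ_∞^n → R`. -/
theorem le_projectiveNorm_basisTensor (φ : Fin n → R.Predual)
    (T : (Fin n → ℂ) →ₗ[ℂ] R.toStarSubalgebra) {C : ℝ} (hC : 0 < C)
    (hT : ∀ (m : ℕ) (v : Matrix (Fin m) (Fin m) (Fin n → ℂ)),
      ‖R.toOperatorMatrix (v.map T)‖ ≤ C * ‖CStarMatrix.ofMatrix v‖) :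
    ‖∑ k, (φ k).1 (T (Pi.single k 1))‖ / C ≤
      projectiveNorm (CStarAlgebra.matrixNormOrder (Fin n → ℂ)) R.predualMatrixNormOrder
        (basisTensor φ) := by
  -- The representation by `diag(e_k) ⊗ diag(φ_k)` shows that the infimum is over a nonempty set.
  refine le_csInf ⟨_, n, n, _, _, Matrix.diagonal φ, _,
    basisTensor_eq φ _ id id fun k => Matrix.diagonal_apply_eq _ _, rfl⟩ ?_
  rintro _ ⟨k, l, α, v, w, β, hz, rfl⟩
  rw [div_le_iff₀ hC, ← dualPairing_basisTensor T φ 0 0]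
  refine (R.norm_dualPairing_scalarSandwich_le T hz (hT k v) 0 0).trans (le_of_eq ?_)
  change _ = ‖α‖ * ‖CStarMatrix.ofMatrix v‖ * _ * ‖β‖ * _
  ring

end VonNeumannAlgebra

/-! ### The free generators -/

theorem freeGeneratorMap_single {n : ℕ} (k : Fin n) :
    freeGeneratorMap n (Pi.single k 1) = groupUnitary (FreeGroup.of k)⁻¹ := by
  simp [freeGeneratorMap, Pi.single_apply]

theorem tracePredual_groupUnitary_inv {G : Type*} [Group G] (g : G) :
    (tracePredual (groupUnitary g)).1 (groupUnitary g⁻¹) = 1 := by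
  rw [tracePredual_groupUnitary_apply, ← groupUnitary_mul, inv_mul_cancel, groupUnitary_one,
    groupTrace_one]

theorem mainTheorem11 (n : ℕ) (hn : 2 ≤ n) :
    deltaNorm (CStarAlgebra.matrixNormOrder (Fin n → ℂ))
        (groupVonNeumannAlgebra (FreeGroup (Fin n))).predualMatrixNormOrder
        (freeGeneratorTensor n) = 1 ∧
      (n : ℝ) / (2 * √((n : ℝ) - 1)) ≤
        projectiveNorm (CStarAlgebra.matrixNormOrder (Fin n → ℂ))
          (groupVonNeumannAlgebra (FreeGroup (Fin n))).predualMatrixNormOrder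
          (freeGeneratorTensor n) := by
  have hn' : (2 : ℝ) ≤ n := by exact_mod_cast hn
  have hc : 0 < 2 * √((n : ℝ) - 1) := mul_pos two_pos (Real.sqrt_pos.2 (by linarith))
  refine ⟨?_, ?_⟩
  -- The tensor unfolds to vector functionals of `δ` and `λ(g_k)δ`; for the lower bound any one
  -- generator suffices, and the first is taken.
  · refine VonNeumannAlgebra.deltaNorm_basisTensor_eq_one _
      (norm_groupVacuum (G := FreeGroup (Fin n))).le
      (fun k => leftRegular (FreeGroup.of k) (groupVacuum _))
      (fun k => vectorFunctional_leftRegular_self _) ⟨0, by omega⟩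
      (y := groupUnitary (FreeGroup.of ⟨0, by omega⟩)⁻¹) ?_ (tracePredual_groupUnitary_inv _)
    rw [star_groupUnitary, ← groupUnitary_mul, inv_mul_cancel, groupUnitary_one]
  · have h := VonNeumannAlgebra.le_projectiveNorm_basisTensor _
      (fun k => tracePredual (groupUnitary (FreeGroup.of k))) (freeGeneratorMap n) hc
      fun m v => norm_toOperatorMatrix_freeGeneratorMap_le hn v
    -- Each of the `n` terms of the pairing is `tr(λ(g_k⁻¹) λ(g_k)) = 1`.
    simp only [freeGeneratorMap_single, tracePredual_groupUnitary_inv, Finset.sum_const,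
      Finset.card_univ, Fintype.card_fin, nsmul_eq_mul, mul_one, Complex.norm_natCast] at h
    exact h
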